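/- All graphs are finite and simple. An incidence of a graph $G$ is a pair $(v,e)$ where $e$ is an edge of $G$ and $v$ is an end of $e$. Two distinct incidences $(u,e)$ and $(v,f)$ are conflicting if (i) $u=v$, or (ii) $uv$ is $e$ or $f$, or (iii) there is a vertex $w$ with $uw=e$ and $vw=f$. A conflict-free incidence $k$-coloring of $G$ is a coloring of the incidences with $k$ colors in which any two conflicting incidences receive distinct colors, and $\chi^c_i(G)$ is the minimum $k$ for which such a coloring exists. A graph is outer-1-planar if it can be drawn in the plane so that all vertices lie on the boundary of the outer face and each edge is crossed at most once. Define the following configurations, in which $x,y$ (for $H_t$: $x_t,y_t$) are the two vertices used for pasting. - $G_2$ has edges $uv,uw,vw,vx,wy$. - $G_4$ has edges $u_0u_1,u_0v_1,u_1v_0,v_0v_1,u_0w,v_0w,u_1x,v_1y$. - $G_8$ has edges $u_0u_1,u_1u_2,u_0v_0,u_0v_1,u_2v_0,v_0v_1,u_2x,v_1y$. - $H_t$ $(t\ge 1)$ has edges $x'y',x'x_0,x'y_0,y'x_0,y'y_0$, the edges $x_{i-1}x_i$ and $y_{i-1}y_i$ for $1\le i\le t$, and the edges $x_iy_i$ for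 $1\le i\le t-1$. Let $\mathcal P$ be the smallest class of graphs, closed under isomorphism, that contains $K_4^+$ (the graph $K_4$ with one edge subdivided once) and is closed under the following two operations on a graph $G\in\mathcal P$: - remove a vertex $z$ of degree two with neighbors $z_1,z_2$, and paste a new copy of $G_2$, $G_4$ or $G_8$ by identifying $x$ with $z_1$ and $y$ with $z_2$; - remove an edge $z_1z_2$, and paste a new copy of $H_t$ for some $t\ge1$ by identifying $x_t$ with $z_1$ and $y_t$ with $z_2$. Let $\mathcal P^+$ be the class of connected outer-1-planar graphs of maximum degree $3$ that contain a member of $\mathcal P$ as a subgraph. **Theorem.** Every graph $G\in\mathcal P^+$ satisfies $\chi^c_i(G)=7$. -/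

import Mathlib

universe u

namespace ConflictFree

variable {V : Type u}

/-! ### Conflict-free incidence colorings -/

/-- An incidence of `G`: a pair `(v, e)` where `e` is an edge of `G` and `v` is an end of `e`. -/
def Incidence (G : SimpleGraph V) : Type u :=
  {p : V × Sym2 V // p.2 ∈ G.edgeSet ∧ p.1 ∈ p.2}

/-- Two incidences `(a, e)` and `(b, f)` are conflicting if `a = b`, or the pair `ab` is one of
`e`, `f`, or there is a vertex `w` with `aw = e` and `bw = f`. -/
def Conflicting {G : SimpleGraph V} (i j : Incidence G) : Prop :=
  i.1.1 = j.1.1 ∨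
  (s(i.1.1, j.1.1) = i.1.2 ∨ s(i.1.1, j.1.1) = j.1.2) ∨
  ∃ w : V, s(i.1.1, w) = i.1.2 ∧ s(j.1.1, w) = j.1.2

/-- A coloring of the incidences is conflict-free if any two (distinct) conflicting incidences
receive distinct colors. -/
def IsConflictFree {G : SimpleGraph V} {C : Type*} (φ : Incidence G → C) : Prop :=
  ∀ i j : Incidence G, i ≠ j → Conflicting i j → φ i ≠ φ j

/-- The conflict-free incidence chromatic number: the minimum `k` such that `G` has a
conflict-free incidence coloring with `k` colors. For a finite graph the set is nonempty. -/
noncomputable def cfIncidenceChromaticNumber (G : SimpleGraph V) : ℕ :=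
  sInf {k : ℕ | ∃ φ : Incidence G → Fin k, IsConflictFree φ}

/-! ### Outer-1-planar graphs -/

/-- The Euclidean plane. -/
abbrev Plane : Type := EuclideanSpace ℝ (Fin 2)

/-- A drawing of `G` in the plane: vertices are distinct points, every edge is a simple arc
joining (the points of) its two ends, and no vertex lies in the interior of an arc. -/
structure Drawing (G : SimpleGraph V) where
  pos : V → Plane
  pos_injective : Function.Injective pos
  curve : G.edgeSet → unitInterval → Plane
  curve_continuous : ∀ e, Continuous (curve e)
  curve_injective : ∀ e, Function.Injective (curve e)
  curve_ends : ∀ e, s(curve e 0, curve e 1) = (e : Sym2 V).map pos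
  curve_avoids : ∀ e, ∀ t ∈ Set.Ioo (0 : unitInterval) 1, ∀ v, curve e t ≠ pos v

namespace Drawing

variable {G : SimpleGraph V}

/-- The arc of `e` without its two endpoints. -/
def edgeInterior (D : Drawing G) (e : G.edgeSet) : Set Plane :=
  D.curve e '' Set.Ioo (0 : unitInterval) 1

/-- The crossings on `e`: pairs `(f, p)` where `f` is another edge and the interiors of the arcs
of `e` and `f` meet in the point `p`. -/
def crossings (D : Drawing G) (e : G.edgeSet) : Set (G.edgeSet × Plane) :=
  {q | q.1 ≠ e ∧ q.2 ∈ D.edgeInterior e ∧ q.2 ∈ D.edgeInterior q.1}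

/-- All points of the plane that belong to the drawing. -/
def support (D : Drawing G) : Set Plane :=
  Set.range D.pos ∪ ⋃ e, Set.range (D.curve e)

/-- The outer face: the points off the drawing whose face (connected component of the complement
of the drawing) is unbounded. -/
def outerFace (D : Drawing G) : Set Plane :=
  {p | p ∈ D.supportᶜ ∧ ¬ Bornology.IsBounded (connectedComponentIn D.supportᶜ p)}

end Drawing

/-- `G` is outer-1-planar if it has a drawing in the plane in which all vertices are on the
boundary of the outer face and each edge is crossed at most once. -/
def IsOuterOnePlanar (G : SimpleGraph V) : Prop :=
  ∃ D : Drawing G, (∀ v, D.pos v ∈ frontier D.outerFace) ∧ ∀ e, (D.crossings e).encard ≤ 1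

/-! ### The configurations and the classes of graphs built from them -/

/-- The two vertices at which a configuration is pasted on a graph. -/
inductive Terminal
  | x
  | y

/-- The vertices of the configuration `G₂` other than `x`, `y`. -/
inductive G2Core
  | u
  | v
  | w

/-- The vertices of the configuration `G₄` other than `x`, `y`. -/
inductive G4Core
  | u0
  | u1
  | v0
  | v1
  | w

/-- The vertices of the configuration `G₈` other than `x`, `y`. -/
inductive G8Core
  | u0
  | u1
  | u2
  | v0
  | v1

/-- The vertices of the configuration `H_t` other than `x_t`, `y_t`: the vertices `x'`, `y'`
(here `xp`, `yp`) and `x_i`, `y_i` for `0 ≤ i < t`. -/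
inductive HCore (t : ℕ)
  | xp
  | yp
  | x (i : Fin t)
  | y (i : Fin t)

open Sum in
/-- The configuration `G₂`: a triangle `uvw` with pendant edges `vx` and `wy`. -/
def configG2 : SimpleGraph (G2Core ⊕ Terminal) :=
  SimpleGraph.fromEdgeSet
    {s(inl .u, inl .v), s(inl .u, inl .w), s(inl .v, inl .w),
      s(inl .v, inr .x), s(inl .w, inr .y)}

open Sum in
/-- The configuration `G₄`. -/
def configG4 : SimpleGraph (G4Core ⊕ Terminal) :=
  SimpleGraph.fromEdgeSet
    {s(inl .u0, inl .u1), s(inl .u0, inl .v1), s(inl .u1, inl .v0), s(inl .v0, inl .v1),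
      s(inl .u0, inl .w), s(inl .v0, inl .w), s(inl .u1, inr .x), s(inl .v1, inr .y)}

open Sum in
/-- The configuration `G₈`. -/
def configG8 : SimpleGraph (G8Core ⊕ Terminal) :=
  SimpleGraph.fromEdgeSet
    {s(inl .u0, inl .u1), s(inl .u1, inl .u2), s(inl .u0, inl .v0), s(inl .u0, inl .v1),
      s(inl .u2, inl .v0), s(inl .v0, inl .v1), s(inl .u2, inr .x), s(inl .v1, inr .y)}

/-- The vertex `x_i` of `H_t` for `0 ≤ i ≤ t`; the last one, `x_t`, is a terminal. -/
def hx (t i : ℕ) : HCore t ⊕ Terminal :=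
  if h : i < t then Sum.inl (.x ⟨i, h⟩) else Sum.inr .x

/-- The vertex `y_i` of `H_t` for `0 ≤ i ≤ t`; the last one, `y_t`, is a terminal. -/
def hy (t i : ℕ) : HCore t ⊕ Terminal :=
  if h : i < t then Sum.inl (.y ⟨i, h⟩) else Sum.inr .y

open Sum in
/-- The configuration `H_t` (`t ≥ 1`): the five edges of `K₄` on `x', y', x_0, y_0` other than
`x_0 y_0`, the two rails `x_0 x_1 … x_t` and `y_0 y_1 … y_t`, and the rungs `x_i y_i` for
`1 ≤ i ≤ t - 1`. -/
def configH (t : ℕ) : SimpleGraph (HCore t ⊕ Terminal) :=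
  SimpleGraph.fromEdgeSet
    ({s(inl .xp, inl .yp), s(inl .xp, hx t 0), s(inl .xp, hy t 0),
        s(inl .yp, hx t 0), s(inl .yp, hy t 0)} ∪
      {e | ∃ i < t, e = s(hx t i, hx t (i + 1)) ∨ e = s(hy t i, hy t (i + 1))} ∪
      {e | ∃ i, 1 ≤ i ∧ i < t ∧ e = s(hx t i, hy t i)})

/-- The vertex of the pasted graph that a vertex of the configuration becomes when `x` is
identified with `z₁` and `y` with `z₂`. -/
def identify {C : Type} (z₁ z₂ : V) : C ⊕ Terminal → V ⊕ C
  | .inl c => .inr c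
  | .inr .x => .inl z₁
  | .inr .y => .inl z₂

/-- Paste a copy of the configuration `B` on the graph `A` by identifying `x` with `z₁` and `y`
with `z₂`. -/
def paste {C : Type} (A : SimpleGraph V) (B : SimpleGraph (C ⊕ Terminal)) (z₁ z₂ : V) :
    SimpleGraph (V ⊕ C) :=
  SimpleGraph.fromEdgeSet
    (Sym2.map Sum.inl '' A.edgeSet ∪ Sym2.map (identify z₁ z₂) '' B.edgeSet)

/-- `K₄⁺`: the complete graph on `0, 1, 2, 3` with the edge `01` subdivided by the vertex `4`. -/
def K4plus : SimpleGraph (Fin 5) :=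
  SimpleGraph.fromEdgeSet {s(0, 4), s(4, 1), s(0, 2), s(0, 3), s(1, 2), s(1, 3), s(2, 3)}

/-- The class `𝒫`: the graphs isomorphic to `K₄⁺`, and all graphs obtained (up to isomorphism)
from a member of the class by one of two kinds of operations: removing a vertex `z` of degree two,
with neighbors `z₁ ≠ z₂`, and pasting a copy of `G₂`, `G₄` or `G₈` at `z₁`, `z₂`; or removing an
edge `z₁z₂` and pasting a copy of `H_t`, `t ≥ 1`, at `z₁`, `z₂`. -/
inductive ClassP : ∀ {V : Type u}, SimpleGraph V → Prop
  | base {V : Type u} {G : SimpleGraph V} (h : Nonempty (G ≃g K4plus)) : ClassP G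
  | pasteG2 {V W : Type u} {G : SimpleGraph V} {G' : SimpleGraph W} (hG : ClassP G)
      (z : V) (z₁ z₂ : ({z}ᶜ : Set V)) (hne : z₁ ≠ z₂)
      (hz : G.neighborSet z = {(z₁ : V), (z₂ : V)})
      (h : Nonempty (G' ≃g paste (G.induce {z}ᶜ) configG2 z₁ z₂)) : ClassP G'
  | pasteG4 {V W : Type u} {G : SimpleGraph V} {G' : SimpleGraph W} (hG : ClassP G)
      (z : V) (z₁ z₂ : ({z}ᶜ : Set V)) (hne : z₁ ≠ z₂)
      (hz : G.neighborSet z = {(z₁ : V), (z₂ : V)})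
      (h : Nonempty (G' ≃g paste (G.induce {z}ᶜ) configG4 z₁ z₂)) : ClassP G'
  | pasteG8 {V W : Type u} {G : SimpleGraph V} {G' : SimpleGraph W} (hG : ClassP G)
      (z : V) (z₁ z₂ : ({z}ᶜ : Set V)) (hne : z₁ ≠ z₂)
      (hz : G.neighborSet z = {(z₁ : V), (z₂ : V)})
      (h : Nonempty (G' ≃g paste (G.induce {z}ᶜ) configG8 z₁ z₂)) : ClassP G'
  | pasteH {V W : Type u} {G : SimpleGraph V} {G' : SimpleGraph W} (hG : ClassP G)
      (z₁ z₂ : V) (hz : G.Adj z₁ z₂) (t : ℕ) (ht : 1 ≤ t)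
      (h : Nonempty (G' ≃g paste (G.deleteEdges {s(z₁, z₂)}) (configH t) z₁ z₂)) : ClassP G'

/-- The class `𝒫⁺`: connected outer-1-planar graphs of maximum degree 3 that contain a member of
`𝒫` as a subgraph. -/
def ClassPPlus [Fintype V] (G : SimpleGraph V) [DecidableRel G.Adj] : Prop :=
  G.Connected ∧ IsOuterOnePlanar G ∧ G.maxDegree = 3 ∧ ∃ H : G.Subgraph, ClassP H.coe

end ConflictFree

/-! Two incidences conflict exactly when their edges share a vertex, an edge counting as meeting
itself (`conflicting_iff_exists_mem`). So a conflict-free k-coloring amounts to giving every edge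
two of k colors such that adjacent edges get disjoint pairs.

Lower bound. Every member of the class `ClassP` has odd order n and at least (3n - 1)/2 edges
(`ClassP.isOverfull`): this holds with equality for `K4plus`, and each pasting adds 2m vertices and
at least 3m edges. A color class is a matching, so six colors serve at most 6(n - 1)/2 = 3n - 3
incidences, fewer than the 3n - 1 required. Colorings restrict to subgraphs.

Upper bound. Seven colors suffice for every finite graph of maximum degree at most three
(`Subcubic.hasPairColoring`), by induction on the number of edges. A diamond can be removed and
colored afterwards, whatever happens at its two attachment vertices; without diamonds, a triangle
can be contracted and each of its edges then takes the pair seen at the opposite corner. In a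
triangle-free graph, take a partial proper 3-edge-coloring with the fewest uncolored edges. By Kempe
chain arguments each uncolored edge xy closes a two-colored path to an odd cycle, and these cycles
are vertex-disjoint (`IsGap.odd`, `IsGap.disjoint`). Off the cycles, color i is replaced by the i-th
of three disjoint pairs. A cycle has length at least five, so it can be colored with the four colors
of its two pairs and the seventh color; the edges leaving it carry the third pair. -/

namespace ConflictFree

open SimpleGraph

/-! ### Kempe chains in partial 3-edge-colorings -/

section

variable {V : Type u} {G : SimpleGraph V} {c : Sym2 V → Option (Fin 3)} {i j : Fin 3}

/-- In a graph of maximum degree two, no component has three vertices of degree at most one. -/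
theorem not_reachable_three_ends [Finite V] {K : SimpleGraph V}
    (hK : ∀ v, (K.neighborSet v).ncard ≤ 2) {x y z : V} (hxy : x ≠ y) (hxz : x ≠ z) (hyz : y ≠ z)
    (hx : (K.neighborSet x).ncard ≤ 1) (hy : (K.neighborSet y).ncard ≤ 1)
    (hz : (K.neighborSet z).ncard ≤ 1) (hrxy : K.Reachable x y) (hrxz : K.Reachable x z) :
    False := by
  classical
  have := Fintype.ofFinite V
  let C := K.connectedComponentMk x
  have hconn : C.toSimpleGraph.Connected := C.connected_toSimpleGraph
  have hle := hconn.card_vert_le_card_edgeSet_add_one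
  have hdeg : ∀ v : C, C.toSimpleGraph.degree v ≤ (K.neighborSet v).ncard := by
    intro v
    rw [← card_neighborFinset_eq_degree, ← Set.ncard_coe_finset, coe_neighborFinset,
      ← Set.ncard_image_of_injective (C.toSimpleGraph.neighborSet v) Subtype.val_injective]
    apply Set.ncard_le_ncard _ (Set.toFinite _)
    rintro _ ⟨w, hw, rfl⟩
    exact hw
  have hsum := C.toSimpleGraph.sum_degrees_eq_twice_card_edges
  let X : C := ⟨x, rfl⟩
  let Y : C := ⟨y, ConnectedComponent.eq.2 hrxy.symm⟩
  let Z : C := ⟨z, ConnectedComponent.eq.2 hrxz.symm⟩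
  have hT : ({X, Y, Z} : Finset C).card = 3 := by
    rw [Finset.card_eq_three]
    exact ⟨X, Y, Z, fun h => hxy (congrArg Subtype.val h),
      fun h => hxz (congrArg Subtype.val h), fun h => hyz (congrArg Subtype.val h), rfl⟩
  -- A connected graph on m vertices has degree sum at least 2m - 2, but three vertices of degree at
  -- most one force it down to 2m - 3.
  have hb : ∑ v : C, (C.toSimpleGraph.degree v + if v ∈ ({X, Y, Z} : Finset C) then 1 else 0)
      ≤ ∑ _v : C, 2 := by
    apply Finset.sum_le_sum
    intro v _
    have h1 := hdeg v
    split_ifs with h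
    · simp only [Finset.mem_insert, Finset.mem_singleton] at h
      rcases h with rfl | rfl | rfl
      · have : (K.neighborSet (X : V)).ncard ≤ 1 := hx
        omega
      · have : (K.neighborSet (Y : V)).ncard ≤ 1 := hy
        omega
      · have : (K.neighborSet (Z : V)).ncard ≤ 1 := hz
        omega
    · have := hK v
      omega
  rw [Finset.sum_add_distrib, hsum, Finset.sum_boole, Finset.filter_mem_eq_inter,
    Finset.univ_inter, hT] at hb
  simp only [Finset.sum_const, Finset.card_univ, smul_eq_mul, Nat.cast_ofNat] at hb
  rw [Nat.card_eq_fintype_card, Nat.card_eq_fintype_card, ← edgeFinset_card] at hle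
  omega

/-- `c` is a partial proper 3-edge-coloring of `G`; `none` marks the uncolored edges. -/
def IsPartialColoring (G : SimpleGraph V) (c : Sym2 V → Option (Fin 3)) : Prop :=
  ∀ ⦃v a b⦄, G.Adj v a → G.Adj v b → a ≠ b → c s(v, a) = c s(v, b) → c s(v, a) = none

/-- The uncolored edges of a partial edge-coloring. -/
def uncolored (G : SimpleGraph V) (c : Sym2 V → Option (Fin 3)) : Set (Sym2 V) :=
  {e | e ∈ G.edgeSet ∧ c e = none}

/-- A partial proper 3-edge-coloring with the fewest uncolored edges. -/
def IsOptimal (G : SimpleGraph V) (c : Sym2 V → Option (Fin 3)) : Prop :=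
  IsPartialColoring G c ∧
    ∀ c', IsPartialColoring G c' → (uncolored G c).ncard ≤ (uncolored G c').ncard

/-- The color `i` is missing at the vertex `v`. -/
def Missing (G : SimpleGraph V) (c : Sym2 V → Option (Fin 3)) (v : V) (i : Fin 3) : Prop :=
  ∀ w, G.Adj v w → c s(v, w) ≠ some i

/-- The subgraph of the edges colored `i` or `j`. -/
def kempe (G : SimpleGraph V) (c : Sym2 V → Option (Fin 3)) (i j : Fin 3) : SimpleGraph V where
  Adj v w := G.Adj v w ∧ (c s(v, w) = some i ∨ c s(v, w) = some j)
  symm := ⟨fun v w h => by rwa [G.adj_comm, Sym2.eq_swap]⟩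
  loopless := ⟨fun v h => G.loopless.irrefl v h.1⟩

theorem exists_isOptimal (G : SimpleGraph V) : ∃ c, IsOptimal G c := by
  have hne : {n | ∃ c, IsPartialColoring G c ∧ (uncolored G c).ncard = n}.Nonempty :=
    ⟨_, fun _ => none, fun _ _ _ _ _ _ _ => rfl, rfl⟩
  obtain ⟨c, hc, hn⟩ := Nat.sInf_mem hne
  refine ⟨c, hc, fun c' hc' => ?_⟩
  rw [hn]
  exact Nat.sInf_le ⟨c', hc', rfl⟩

theorem kempe_comm : kempe G c i j = kempe G c j i := by
  ext v w
  simp [kempe, or_comm]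

theorem IsPartialColoring.eq_of_eq_some (hc : IsPartialColoring G c) {v a b : V} (ha : G.Adj v a)
    (hb : G.Adj v b) (hca : c s(v, a) = some i) (hcb : c s(v, b) = some i) : a = b := by
  by_contra h
  have := hc ha hb h (hca.trans hcb.symm)
  simp [hca] at this

theorem IsPartialColoring.ncard_kempe_le_one [Finite V] (hc : IsPartialColoring G c) {v : V}
    (hv : Missing G c v i) : ((kempe G c i j).neighborSet v).ncard ≤ 1 := by
  rw [Set.ncard_le_one (Set.toFinite _)]
  rintro a ⟨ha, ha'⟩ b ⟨hb, hb'⟩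
  exact hc.eq_of_eq_some ha hb (ha'.resolve_left (hv a ha)) (hb'.resolve_left (hv b hb))

theorem IsPartialColoring.ncard_kempe_le_one' [Finite V] (hc : IsPartialColoring G c) {v : V}
    (hv : Missing G c v j) : ((kempe G c i j).neighborSet v).ncard ≤ 1 := by
  rw [kempe_comm]
  exact hc.ncard_kempe_le_one hv

theorem IsPartialColoring.ncard_kempe_le_two [Finite V] (hc : IsPartialColoring G c) (v : V) :
    ((kempe G c i j).neighborSet v).ncard ≤ 2 := by
  have hsub : (kempe G c i j).neighborSet v ⊆
      {a | G.Adj v a ∧ c s(v, a) = some i} ∪ {a | G.Adj v a ∧ c s(v, a) = some j} := by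
    rintro a ⟨ha, h | h⟩
    · exact Or.inl ⟨ha, h⟩
    · exact Or.inr ⟨ha, h⟩
  have h1 : ∀ k : Fin 3, ({a | G.Adj v a ∧ c s(v, a) = some k} : Set V).ncard ≤ 1 := by
    intro k
    rw [Set.ncard_le_one (Set.toFinite _)]
    rintro a ⟨ha, ha'⟩ b ⟨hb, hb'⟩
    exact hc.eq_of_eq_some ha hb ha' hb'
  have := Set.ncard_le_ncard hsub (Set.toFinite _)
  have := Set.ncard_union_le {a | G.Adj v a ∧ c s(v, a) = some i}
    {a | G.Adj v a ∧ c s(v, a) = some j}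
  have := h1 i
  have := h1 j
  omega

/-- Three vertices which each miss one of two colors are not in one Kempe component. -/
theorem IsPartialColoring.not_three_ends [Finite V] (hc : IsPartialColoring G c) {x y z : V}
    (hxy : x ≠ y) (hxz : x ≠ z) (hyz : y ≠ z)
    (hx : Missing G c x i ∨ Missing G c x j) (hy : Missing G c y i ∨ Missing G c y j)
    (hz : Missing G c z i ∨ Missing G c z j) (hrxy : (kempe G c i j).Reachable x y)
    (hrxz : (kempe G c i j).Reachable x z) : False := by
  have h : ∀ {v}, Missing G c v i ∨ Missing G c v j →
      ((kempe G c i j).neighborSet v).ncard ≤ 1 := fun hv =>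
    hv.elim hc.ncard_kempe_le_one hc.ncard_kempe_le_one'
  exact not_reachable_three_ends hc.ncard_kempe_le_two hxy hxz hyz (h hx) (h hy) (h hz) hrxy hrxz

/-- The ends of an uncolored edge of an optimal coloring miss no common color. -/
theorem IsOptimal.not_missing_common [Finite V] (hc : IsOptimal G c) {x y : V} (hxy : G.Adj x y)
    (hn : c s(x, y) = none) (hx : Missing G c x i) (hy : Missing G c y i) : False := by
  classical
  let c' := Function.update c s(x, y) (some i)
  have hold : ∀ {e}, e ≠ s(x, y) → c' e = c e := fun h => Function.update_of_ne h _ _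
  have hnew : c' s(x, y) = some i := Function.update_self ..
  have hmiss : ∀ v a, s(v, a) = s(x, y) → Missing G c v i := by
    intro v a h
    rcases Sym2.eq_iff.1 h with ⟨rfl, -⟩ | ⟨rfl, -⟩ <;> assumption
  have hc' : IsPartialColoring G c' := by
    intro v a b ha hb hab h
    by_cases h1 : s(v, a) = s(x, y)
    · have h2 : s(v, b) ≠ s(x, y) := fun h2 => hab (Sym2.congr_right.1 (h1.trans h2.symm))
      rw [h1, hnew, hold h2] at h
      exact absurd h.symm (hmiss v a h1 b hb)
    · by_cases h2 : s(v, b) = s(x, y)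
      · rw [h2, hnew, hold h1] at h
        exact absurd h (hmiss v b h2 a ha)
      · rw [hold h1, hold h2] at h
        rw [hold h1]
        exact hc.1 ha hb hab h
  have hlt : (uncolored G c').ncard < (uncolored G c).ncard := by
    apply Set.ncard_lt_ncard _ (Set.toFinite _)
    refine Set.ssubset_iff_exists.2 ⟨?_, s(x, y), ⟨hxy, hn⟩, ?_⟩
    · rintro e ⟨he, h⟩
      refine ⟨he, ?_⟩
      by_cases h1 : e = s(x, y)
      · rw [h1, hn]
      · rwa [hold h1] at h
    · rintro ⟨-, h⟩
      simp [hnew] at h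
  exact absurd (hc.2 c' hc') (not_le.2 hlt)

open Classical in
/-- Exchange the colors `i` and `j` on the Kempe component of `x`. -/
noncomputable def kempeSwap (G : SimpleGraph V) (c : Sym2 V → Option (Fin 3)) (i j : Fin 3)
    (x : V) (e : Sym2 V) : Option (Fin 3) :=
  if ∃ v ∈ e, (kempe G c i j).Reachable x v then (c e).map (Equiv.swap i j) else c e

theorem kempeSwap_of_reachable {x v a : V} (h : (kempe G c i j).Reachable x v) :
    kempeSwap G c i j x s(v, a) = (c s(v, a)).map (Equiv.swap i j) :=
  if_pos ⟨v, Sym2.mem_mk_left v a, h⟩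

/-- An edge may have its other end in the swapped component, but then its color is neither `i` nor
`j`, and the swap fixes it. -/
theorem kempeSwap_of_not_reachable {x v a : V} (hva : G.Adj v a)
    (h : ¬ (kempe G c i j).Reachable x v) : kempeSwap G c i j x s(v, a) = c s(v, a) := by
  rw [kempeSwap]
  split_ifs with h1
  · obtain ⟨w, hw, hr⟩ := h1
    rcases Sym2.mem_iff.1 hw with rfl | rfl
    · exact absurd hr h
    · have hnot : ¬ (c s(v, w) = some i ∨ c s(v, w) = some j) := fun hcol =>
        h (hr.trans (Adj.reachable (G := kempe G c i j) ⟨hva, hcol⟩).symm)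
      cases hcv : c s(v, w) with
      | none => rfl
      | some k =>
        simp only [hcv, Option.some.injEq, not_or] at hnot
        simp [Equiv.swap_apply_of_ne_of_ne hnot.1 hnot.2]
  · rfl

theorem kempeSwap_eq_none {x : V} {e : Sym2 V} : kempeSwap G c i j x e = none ↔ c e = none := by
  rw [kempeSwap]
  split_ifs <;> simp

/-- Around any one vertex the swap acts on all colors by the same permutation: the transposition or
the identity. -/
theorem IsPartialColoring.kempeSwap (hc : IsPartialColoring G c) (i j : Fin 3) (x : V) :
    IsPartialColoring G (kempeSwap G c i j x) := by
  intro v a b ha hb hab h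
  rw [kempeSwap_eq_none]
  apply hc ha hb hab
  by_cases hv : (kempe G c i j).Reachable x v
  · rw [kempeSwap_of_reachable hv, kempeSwap_of_reachable hv] at h
    exact Option.map_injective (Equiv.injective _) h
  · rwa [kempeSwap_of_not_reachable ha hv, kempeSwap_of_not_reachable hb hv] at h

theorem uncolored_kempeSwap (x : V) : uncolored G (kempeSwap G c i j x) = uncolored G c := by
  ext e
  simp [uncolored, kempeSwap_eq_none]

theorem IsOptimal.kempeSwap (hc : IsOptimal G c) (i j : Fin 3) (x : V) :
    IsOptimal G (kempeSwap G c i j x) :=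
  ⟨hc.1.kempeSwap i j x, fun c' hc' => by rw [uncolored_kempeSwap]; exact hc.2 c' hc'⟩

/-- The ends of an uncolored edge are joined by the Kempe chain of two missing colors. -/
theorem IsOptimal.reachable [Finite V] (hc : IsOptimal G c) {x y : V} (hxy : G.Adj x y)
    (hn : c s(x, y) = none) (hx : Missing G c x i) (hy : Missing G c y j) :
    (kempe G c i j).Reachable x y := by
  by_contra h
  -- If `y` were outside the chain of `x`, swapping on that chain would make `j` missing at `x` and
  -- change nothing at `y`.
  apply (hc.kempeSwap i j x).not_missing_common hxy (kempeSwap_eq_none.2 hn) (i := j)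
  · intro w hw h1
    rw [kempeSwap_of_reachable Reachable.rfl, Option.map_eq_some_iff] at h1
    obtain ⟨k, hk, hkj⟩ := h1
    have : k = i := (Equiv.swap i j).injective (hkj.trans (Equiv.swap_apply_left i j).symm)
    exact hx w hw (this ▸ hk)
  · intro w hw h1
    rw [kempeSwap_of_not_reachable hw h] at h1
    exact hy w hw h1

end

/-! ### Cyclic numberings of the edges of a cycle -/

section

variable {V : Type u} {G : SimpleGraph V} {c : Sym2 V → Option (Fin 3)} {i j : Fin 3}

/-- Every vertex has at most three neighbors. -/
def Subcubic (G : SimpleGraph V) : Prop := ∀ v, (G.neighborSet v).ncard ≤ 3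

theorem Subcubic.not_four [Finite V] (hG : Subcubic G) {v a b d e : V} (ha : G.Adj v a)
    (hb : G.Adj v b) (hd : G.Adj v d) (he : G.Adj v e) (hab : a ≠ b) (had : a ≠ d) (hae : a ≠ e)
    (hbd : b ≠ d) (hbe : b ≠ e) (hde : d ≠ e) : False := by
  have hsub : ({a, b, d, e} : Set V) ⊆ G.neighborSet v := by
    rintro w (rfl | rfl | rfl | rfl) <;> assumption
  have h4 : ({a, b, d, e} : Set V).ncard = 4 := by
    rw [Set.ncard_insert_of_notMem (by simp [*]), Set.ncard_insert_of_notMem (by simp [*]),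
      Set.ncard_pair hde]
  have := Set.ncard_le_ncard hsub (Set.toFinite _)
  have := hG v
  omega

theorem exists_missing [Finite V] (hG : Subcubic G) {x y : V} (hxy : G.Adj x y)
    (hn : c s(x, y) = none) : ∃ i, Missing G c x i := by
  by_contra! h
  simp only [Missing, not_forall, not_not] at h
  choose w hw hcw using h
  have h1 : ∀ k, y ≠ w k := by
    rintro k rfl
    simp [hcw] at hn
  have h2 : ∀ k l, k ≠ l → w k ≠ w l := by
    intro k l hkl h
    have := hcw k
    rw [h, hcw l] at this
    exact hkl (Option.some.inj this).symm
  exact hG.not_four hxy (hw 0) (hw 1) (hw 2) (h1 0) (h1 1) (h1 2) (h2 0 1 (by decide))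
    (h2 0 2 (by decide)) (h2 1 2 (by decide))

/-- The uncolored edges of an optimal coloring form a matching. -/
theorem IsOptimal.uncolored_matching [Finite V] (hG : Subcubic G) (hc : IsOptimal G c)
    {v x y : V} (hx : G.Adj v x) (hy : G.Adj v y) (hnx : c s(v, x) = none)
    (hny : c s(v, y) = none) : x = y := by
  by_contra hxy
  -- Two uncolored edges leave room for only one colored edge at `v`.
  have hor : ∀ k l, k ≠ l → Missing G c v k ∨ Missing G c v l := by
    intro k l hkl
    by_contra! h
    simp only [Missing, not_forall, not_not] at h
    obtain ⟨⟨a, ha, hca⟩, b, hb, hcb⟩ := h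
    refine hG.not_four hx hy ha hb hxy ?_ ?_ ?_ ?_ ?_ <;> rintro rfl <;> simp_all
  obtain ⟨i, hi⟩ : ∃ i, ∀ k, k ≠ i → Missing G c v k := by
    by_contra! h
    obtain ⟨k, -, hk⟩ := h 0
    obtain ⟨l, hl, hl'⟩ := h k
    exact (hor l k hl).elim hl' hk
  -- Any missing color of `w` other than `i` is also missing at `v`, which optimality forbids. Hence
  -- `v`, `x`, `y` are three ends of one Kempe chain.
  have hend : ∀ w, G.Adj v w → c s(v, w) = none → Missing G c w i := by
    intro w hw hnw
    obtain ⟨k, hk⟩ := exists_missing hG hw.symm (by rwa [Sym2.eq_swap])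
    by_cases hki : k = i
    · exact hki ▸ hk
    · exact (hc.not_missing_common hw hnw (hi k hki) hk).elim
  obtain ⟨j, hj⟩ := exists_ne i
  exact hc.1.not_three_ends hx.ne hy.ne hxy (Or.inl (hi j hj)) (Or.inr (hend x hx hnx))
    (Or.inr (hend y hy hny)) (hc.reachable hx hnx (hi j hj) (hend x hx hnx))
    (hc.reachable hy hny (hi j hj) (hend y hy hny))

/-- `k` numbers the edges of the cycle `L` cyclically by `0, …, n - 1`, beginning and ending
at `v`. -/
structure IsCyclicIndexing (L : SimpleGraph V) (v : V) (n : ℕ) (k : Sym2 V → ℕ) : Prop where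
  three_le : 3 ≤ n
  lt : ∀ {u w}, L.Adj u w → k s(u, w) < n
  inj : ∀ {e f}, e ∈ L.edgeSet → f ∈ L.edgeSet → k e = k f → e = f
  step : ∀ {u a b}, L.Adj u a → L.Adj u b → a ≠ b →
    (k s(u, b) = k s(u, a) + 1 ∨ k s(u, a) = n - 1 ∧ k s(u, b) = 0) ∨
    (k s(u, a) = k s(u, b) + 1 ∨ k s(u, b) = n - 1 ∧ k s(u, a) = 0)
  start : ∃ a b, a ≠ b ∧ L.Adj v a ∧ L.Adj v b ∧ k s(v, a) = 0 ∧ k s(v, b) = n - 1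
  triangle : n = 3 → ∃ a b, L.Adj v a ∧ L.Adj a b ∧ L.Adj b v

/-- An edge is numbered by its position in the edge list of the cycle. -/
theorem _root_.SimpleGraph.Walk.IsCycle.exists_indexing {L : SimpleGraph V} {v : V}
    {p : L.Walk v v} (hp : p.IsCycle) (hall : ∀ e ∈ L.edgeSet, e ∈ p.edges) :
    ∃ n k, IsCyclicIndexing L v n k := by
  classical
  have h3 := hp.three_le_length
  have hlen := p.length_edges
  have hk : ∀ {e}, e ∈ L.edgeSet → p.edges.idxOf e < p.length := fun he => by
    rw [← hlen]
    exact List.idxOf_lt_length_iff.2 (hall _ he)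
  have hg : ∀ {e}, e ∈ L.edgeSet →
      e = s(p.getVert (p.edges.idxOf e), p.getVert (p.edges.idxOf e + 1)) := fun he => by
    have hlt := List.idxOf_lt_length_iff.2 (hall _ he)
    rw [← p.getElem_edges hlt, List.getElem_idxOf hlt]
  have hidx : ∀ m, m < p.length → p.edges.idxOf s(p.getVert m, p.getVert (m + 1)) = m := by
    intro m hm
    have hm' : m < p.edges.length := by omega
    rw [← p.getElem_edges hm']
    exact hp.isTrail.edges_nodup.idxOf_getElem m hm'
  have hinj : ∀ {e f}, e ∈ L.edgeSet → f ∈ L.edgeSet →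
      p.edges.idxOf e = p.edges.idxOf f → e = f := by
    intro e f he hf h
    rw [hg he, hg hf, h]
  have hadj : ∀ m, m < p.length → L.Adj (p.getVert m) (p.getVert (m + 1)) :=
    fun m hm => p.adj_getVert_succ hm
  have h0 : p.getVert 0 = v := p.getVert_zero
  have hn : p.getVert p.length = v := p.getVert_length
  refine ⟨p.length, p.edges.idxOf, h3, fun h => hk h, hinj, ?_, ?_, ?_⟩
  · intro u a b ha hb hab
    have hne : p.edges.idxOf s(u, a) ≠ p.edges.idxOf s(u, b) := fun h =>
      hab (Sym2.congr_right.1 (hinj ha hb h))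
    have hka := hk (e := s(u, a)) ha
    have hkb := hk (e := s(u, b)) hb
    have ma : u ∈ s(p.getVert (p.edges.idxOf s(u, a)), p.getVert (p.edges.idxOf s(u, a) + 1)) := by
      rw [← hg (e := s(u, a)) ha]; exact Sym2.mem_mk_left _ _
    have mb : u ∈ s(p.getVert (p.edges.idxOf s(u, b)), p.getVert (p.edges.idxOf s(u, b) + 1)) := by
      rw [← hg (e := s(u, b)) hb]; exact Sym2.mem_mk_left _ _
    generalize p.edges.idxOf s(u, a) = k at *
    generalize p.edges.idxOf s(u, b) = l at *
    -- Positions 0 and `p.length` are the same vertex. Replacing position 0 by `p.length` allows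
    -- injectivity on positive positions to be used, and produces the wrap-around case.
    have key : ∀ {k l}, k < p.length → l < p.length → p.getVert k = p.getVert (l + 1) →
        k = l + 1 ∨ l = p.length - 1 ∧ k = 0 := by
      intro k l hk hl h
      rcases Nat.eq_zero_or_pos k with rfl | hpos
      · have := hp.getVert_injOn (by simp; omega) (by simp; omega) ((hn.trans h0.symm).trans h)
        omega
      · exact Or.inl (hp.getVert_injOn (by simp; omega) (by simp; omega) h)
    rcases Sym2.mem_iff.1 ma with h | h <;> rcases Sym2.mem_iff.1 mb with h' | h'
    · exact absurd (hp.getVert_injOn' (by simp; omega) (by simp; omega) (h.symm.trans h')) hne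
    · exact Or.inr (key hka hkb (h.symm.trans h'))
    · exact Or.inl (key hkb hka (h'.symm.trans h))
    · have := hp.getVert_injOn (by simp; omega) (by simp; omega) (h.symm.trans h')
      omega
  · refine ⟨p.getVert 1, p.getVert (p.length - 1), ?_, ?_, ?_, ?_, ?_⟩
    · intro h
      have := hp.getVert_injOn (by simp; omega) (by simp; omega) h
      omega
    · simpa [h0] using hadj 0 (by omega)
    · have := hadj (p.length - 1) (by omega)
      rw [Nat.sub_add_cancel (by omega), hn] at this
      exact this.symm
    · simpa [h0] using hidx 0 (by omega)
    · have := hidx (p.length - 1) (by omega)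
      rwa [Nat.sub_add_cancel (by omega), hn, Sym2.eq_swap] at this
  · intro h
    refine ⟨p.getVert 1, p.getVert 2, ?_, hadj 1 (by omega), ?_⟩
    · simpa [h0] using hadj 0 (by omega)
    · have := hadj 2 (by omega)
      rwa [show 2 + 1 = p.length by omega, hn] at this

end

/-! ### The odd cycle through an uncolored edge -/

section

variable {V : Type u} {G : SimpleGraph V} {c : Sym2 V → Option (Fin 3)} {i j : Fin 3} {x y : V}

/-- The edge `xy` is uncolored, `i` is missing at `x` and `j ≠ i` is missing at `y`. -/
structure IsGap (G : SimpleGraph V) (c : Sym2 V → Option (Fin 3)) (i j : Fin 3) (x y : V) :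
    Prop where
  adj : G.Adj x y
  eq_none : c s(x, y) = none
  ne : i ≠ j
  left : Missing G c x i
  right : Missing G c y j

/-- The Kempe component of `x` for the colors `i`, `j`, together with the edge `xy`. -/
def gapCycle (G : SimpleGraph V) (c : Sym2 V → Option (Fin 3)) (i j : Fin 3) (x y : V) :
    SimpleGraph V where
  Adj u w := (kempe G c i j).Reachable x u ∧ (kempe G c i j).Reachable x w ∧ G.Adj u w ∧
    (s(u, w) = s(x, y) ∨ c s(u, w) = some i ∨ c s(u, w) = some j)
  symm := ⟨fun u w h => ⟨h.2.1, h.1, h.2.2.1.symm, by rw [Sym2.eq_swap]; exact h.2.2.2⟩⟩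
  loopless := ⟨fun u h => h.2.2.1.ne rfl⟩

theorem gapCycle_adj_of_color {u w : V} (hu : (kempe G c i j).Reachable x u) (h : G.Adj u w)
    (hcol : c s(u, w) = some i ∨ c s(u, w) = some j) : (gapCycle G c i j x y).Adj u w :=
  ⟨hu, hu.trans (Adj.reachable ⟨h, hcol⟩), h, Or.inr hcol⟩

variable [Finite V]

theorem IsGap.adj_gapCycle (h : IsGap G c i j x y) (hc : IsOptimal G c) :
    (gapCycle G c i j x y).Adj x y :=
  ⟨Reachable.rfl, hc.reachable h.adj h.eq_none h.left h.right, h.adj, Or.inl rfl⟩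

/-- Every vertex of the Kempe component has exactly two neighbors in the cycle. -/
theorem IsGap.exists_neighbors (h : IsGap G c i j x y) (hc : IsOptimal G c) {v : V}
    (hv : (kempe G c i j).Reachable x v) :
    ∃ a b, a ≠ b ∧ ∀ w, (gapCycle G c i j x y).Adj v w ↔ w = a ∨ w = b := by
  have hxy := hc.reachable h.adj h.eq_none h.left h.right
  by_cases hvx : v = x
  · subst hvx
    obtain ⟨b, hb, hcb⟩ : ∃ b, G.Adj v b ∧ c s(v, b) = some j := by
      by_contra! hj
      exact hc.not_missing_common h.adj h.eq_none hj h.right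
    refine ⟨y, b, ?_, fun w => ⟨?_, ?_⟩⟩
    · rintro rfl
      simp [h.eq_none] at hcb
    · rintro ⟨-, -, hw, h1 | h1 | h1⟩
      · exact Or.inl (Sym2.congr_right.1 h1)
      · exact absurd h1 (h.left w hw)
      · exact Or.inr (hc.1.eq_of_eq_some hw hb h1 hcb)
    · rintro (rfl | rfl)
      · exact h.adj_gapCycle hc
      · exact gapCycle_adj_of_color hv hb (Or.inr hcb)
  by_cases hvy : v = y
  · subst hvy
    obtain ⟨b, hb, hcb⟩ : ∃ b, G.Adj v b ∧ c s(v, b) = some i := by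
      by_contra! hi
      exact hc.not_missing_common h.adj h.eq_none h.left hi
    refine ⟨x, b, ?_, fun w => ⟨?_, ?_⟩⟩
    · rintro rfl
      rw [Sym2.eq_swap, h.eq_none] at hcb
      simp at hcb
    · rintro ⟨-, -, hw, h1 | h1 | h1⟩
      · rw [Sym2.eq_swap] at h1
        exact Or.inl (Sym2.congr_left.1 h1)
      · exact Or.inr (hc.1.eq_of_eq_some hw hb h1 hcb)
      · exact absurd h1 (h.right w hw)
    · rintro (rfl | rfl)
      · exact (h.adj_gapCycle hc).symm
      · exact gapCycle_adj_of_color hv hb (Or.inl hcb)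
  -- A further vertex missing `i` or `j` would be a third end of the chain from `x` to `y`.
  have hsees : ∀ k, (k = i ∨ k = j) → ∃ b, G.Adj v b ∧ c s(v, b) = some k := by
    intro k hk
    by_contra! hmiss
    refine hc.1.not_three_ends h.adj.ne (Ne.symm hvx) (Ne.symm hvy) (Or.inl h.left)
      (Or.inr h.right) ?_ hxy hv
    rcases hk with rfl | rfl
    · exact Or.inl hmiss
    · exact Or.inr hmiss
  obtain ⟨a, ha, hca⟩ := hsees i (Or.inl rfl)
  obtain ⟨b, hb, hcb⟩ := hsees j (Or.inr rfl)
  refine ⟨a, b, ?_, fun w => ⟨?_, ?_⟩⟩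
  · rintro rfl
    exact h.ne (Option.some.inj (hca.symm.trans hcb))
  · rintro ⟨-, -, hw, h1 | h1 | h1⟩
    · rcases Sym2.eq_iff.1 h1 with ⟨h1, -⟩ | ⟨h1, -⟩
      · exact absurd h1 hvx
      · exact absurd h1 hvy
    · exact Or.inl (hc.1.eq_of_eq_some hw ha h1 hca)
    · exact Or.inr (hc.1.eq_of_eq_some hw hb h1 hcb)
  · rintro (rfl | rfl)
    · exact gapCycle_adj_of_color hv ha (Or.inl hca)
    · exact gapCycle_adj_of_color hv hb (Or.inr hcb)

theorem IsGap.ncard_neighborSet (h : IsGap G c i j x y) (hc : IsOptimal G c) {v : V}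
    (hv : (kempe G c i j).Reachable x v) :
    ((gapCycle G c i j x y).neighborSet v).ncard = 2 := by
  obtain ⟨a, b, hab, hw⟩ := h.exists_neighbors hc hv
  rw [Set.ncard_eq_two]
  exact ⟨a, b, hab, Set.ext hw⟩

omit [Finite V] in
theorem reachable_gapCycle {v : V} (hv : (kempe G c i j).Reachable x v) :
    (gapCycle G c i j x y).Reachable x v := by
  obtain ⟨p⟩ := hv.symm
  induction p with
  | nil => rfl
  | cons hadj p ih =>
    have hw := (p.reachable).symm
    exact (ih hw).trans (Adj.reachable (gapCycle_adj_of_color hw hadj.1.symm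
      (by rw [Sym2.eq_swap]; exact hadj.2)))

theorem IsGap.exists_indexing (h : IsGap G c i j x y) (hc : IsOptimal G c) {v : V}
    (hv : (kempe G c i j).Reachable x v) :
    ∃ n k, IsCyclicIndexing (gapCycle G c i j x y) v n k := by
  set L := gapCycle G c i j x y with hL
  have hcyc : L.IsCycles := fun u ⟨w, hw⟩ => h.ncard_neighborSet hc hw.1
  have hne : (L.neighborSet v).Nonempty := by
    rw [← Set.ncard_pos, h.ncard_neighborSet hc hv]
    norm_num
  obtain ⟨p, hp, hsupp⟩ := hcyc.exists_cycle_toSubgraph_verts_eq_connectedComponentSupp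
    (c := L.connectedComponentMk v) rfl hne
  refine hp.exists_indexing (fun e => ?_)
  induction e with | _ u w
  intro he
  have hu : u ∈ p.toSubgraph.verts := by
    rw [hsupp]
    exact ConnectedComponent.sound
      ((reachable_gapCycle he.1).symm.trans (reachable_gapCycle hv))
  -- The cycle visits every vertex of the component and uses two edges there, hence all edges of `L`
  -- there.
  have heq : p.toSubgraph.neighborSet u = L.neighborSet u := by
    apply Set.eq_of_subset_of_ncard_le (p.toSubgraph.neighborSet_subset u) _ (Set.toFinite _)
    rw [h.ncard_neighborSet hc he.1,
      hp.ncard_neighborSet_toSubgraph_eq_two (p.mem_verts_toSubgraph.1 hu)]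
  have : w ∈ p.toSubgraph.neighborSet u := heq ▸ he
  rwa [← p.mem_edges_toSubgraph]

open Classical in
/-- Recolor the edges of the graph `L` by the function `g`. -/
noncomputable def recolor (L : SimpleGraph V) (c g : Sym2 V → Option (Fin 3)) (e : Sym2 V) :
    Option (Fin 3) :=
  if e ∈ L.edgeSet then g e else c e

omit [Finite V] in
theorem recolor_of_adj {L : SimpleGraph V} {g : Sym2 V → Option (Fin 3)} {u w : V}
    (h : L.Adj u w) : recolor L c g s(u, w) = g s(u, w) := if_pos h

omit [Finite V] in
theorem recolor_of_not_adj {L : SimpleGraph V} {g : Sym2 V → Option (Fin 3)} {u w : V}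
    (h : ¬ L.Adj u w) : recolor L c g s(u, w) = c s(u, w) := if_neg h

omit [Finite V] in
-- At a vertex of the cycle every edge colored `i` or `j` lies on the cycle, so new colors `i` and
-- `j` there can clash only among themselves.
theorem IsPartialColoring.recolor (hc : IsPartialColoring G c)
    {g : Sym2 V → Option (Fin 3)} (hg : ∀ e, g e = none ∨ g e = some i ∨ g e = some j)
    (hp : ∀ u a b, (gapCycle G c i j x y).Adj u a → (gapCycle G c i j x y).Adj u b → a ≠ b →
      g s(u, a) = g s(u, b) → g s(u, a) = none) :
    IsPartialColoring G (recolor (gapCycle G c i j x y) c g) := by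
  have key : ∀ {u a b}, (gapCycle G c i j x y).Adj u a → G.Adj u b →
      ¬ (gapCycle G c i j x y).Adj u b → c s(u, b) = g s(u, a) → g s(u, a) = none := by
    intro u a b ha hb hnb h
    refine (hg s(u, a)).resolve_right (fun hcol => hnb ?_)
    rw [← h] at hcol
    exact gapCycle_adj_of_color ha.1 hb hcol
  intro u a b ha hb hab h
  by_cases hla : (gapCycle G c i j x y).Adj u a <;> by_cases hlb : (gapCycle G c i j x y).Adj u b
  · rw [recolor_of_adj hla, recolor_of_adj hlb] at h
    rw [recolor_of_adj hla]
    exact hp u a b hla hlb hab h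
  · rw [recolor_of_adj hla, recolor_of_not_adj hlb] at h
    rw [recolor_of_adj hla]
    exact key hla hb hlb h.symm
  · rw [recolor_of_not_adj hla, recolor_of_adj hlb] at h
    rw [recolor_of_not_adj hla, h]
    exact key hlb ha hla h
  · rw [recolor_of_not_adj hla, recolor_of_not_adj hlb] at h
    rw [recolor_of_not_adj hla]
    exact hc ha hb hab h

/-- The cycle of a gap is odd. -/
theorem IsGap.odd (h : IsGap G c i j x y) (hc : IsOptimal G c) {v : V} {n : ℕ} {k : Sym2 V → ℕ}
    (hk : IsCyclicIndexing (gapCycle G c i j x y) v n k) : Odd n := by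
  by_contra hn
  rw [Nat.not_odd_iff_even] at hn
  -- An even cycle could be colored alternately, which would also color `xy`.
  let g : Sym2 V → Option (Fin 3) := fun e => if Even (k e) then some i else some j
  have hgne : ∀ e, g e ≠ none := fun e => by simp only [g]; split_ifs <;> simp
  have hpar : ∀ {e f}, g e = g f → (Even (k e) ↔ Even (k f)) := by
    intro e f hef
    have := h.ne
    simp only [g] at hef
    split_ifs at hef <;> simp_all [-Nat.not_even_iff_odd]
  have h3 := hk.three_le
  have hnew := hc.1.recolor (x := x) (y := y) (i := i) (j := j) (g := g)
    (fun e => by simp only [g]; split_ifs <;> simp) (by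
      intro u a b ha hb hab hg
      have := hpar hg
      have := hk.step ha hb hab
      have := hk.lt ha
      exfalso
      grind)
  have hlt : (uncolored G (recolor (gapCycle G c i j x y) c g)).ncard < (uncolored G c).ncard := by
    apply Set.ncard_lt_ncard _ (Set.toFinite _)
    refine Set.ssubset_iff_exists.2 ⟨?_, s(x, y), ⟨h.adj, h.eq_none⟩, ?_⟩
    · rintro e ⟨he, h1⟩
      refine ⟨he, ?_⟩
      unfold recolor at h1
      split_ifs at h1
      · exact absurd h1 (hgne e)
      · exact h1
    · rintro ⟨-, h1⟩
      rw [recolor_of_adj (h.adj_gapCycle hc)] at h1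
      exact hgne _ h1
  exact absurd (hc.2 _ hnew) (not_le.2 hlt)

/-- The uncolored edge can be moved along its cycle to any vertex, so that there any one of the
two colors is missing. -/
theorem IsGap.rotate (h : IsGap G c i j x y) (hc : IsOptimal G c) {v : V}
    (hv : (kempe G c i j).Reachable x v) {s : Fin 3} (hs : s = i ∨ s = j) :
    ∃ c', IsOptimal G c' ∧ (∀ e, e ∉ (gapCycle G c i j x y).edgeSet → c' e = c e) ∧
      Missing G c' v s ∧ ∃ a, (gapCycle G c i j x y).Adj v a ∧ c' s(v, a) = none := by
  obtain ⟨t, hts, ht⟩ : ∃ t, t ≠ s ∧ (t = i ∨ t = j) := by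
    have := h.ne
    rcases hs with rfl | rfl
    · exact ⟨j, this.symm, Or.inr rfl⟩
    · exact ⟨i, this, Or.inl rfl⟩
  obtain ⟨n, k, hk⟩ := h.exists_indexing hc hv
  have hn := h.odd hc hk
  have h3 := hk.three_le
  obtain ⟨a, b, hab, ha, hb, hka, hkb⟩ := hk.start
  -- Edge 0, at `v`, becomes the uncolored one and the others alternate. Since `n - 1` is even, the
  -- last edge, also at `v`, gets `t`, so `s` is missing at `v`.
  let g : Sym2 V → Option (Fin 3) := fun e =>
    if k e = 0 then none else if Even (k e) then some t else some s
  have hpar : ∀ {e f}, g e = g f → (k e = 0 ∧ k f = 0) ∨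
      (k e ≠ 0 ∧ k f ≠ 0 ∧ (Even (k e) ↔ Even (k f))) := by
    intro e f hef
    simp only [g] at hef
    split_ifs at hef <;> simp_all [-Nat.not_even_iff_odd]
  have hnew := hc.1.recolor (x := x) (y := y) (i := i) (j := j) (g := g)
    (fun e => by simp only [g]; split_ifs <;> simp <;> grind) (by
      intro u p q hp hq hpq hg
      have := hpar hg
      have := hk.step hp hq hpq
      have := hk.lt hp
      exfalso
      grind)
  have hga : g s(v, a) = none := if_pos hka
  have hgb : g s(v, b) = some t := by
    simp only [g, hkb]
    rw [if_neg (by omega), if_pos (by grind)]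
  have hle : (uncolored G (recolor (gapCycle G c i j x y) c g)).ncard ≤ (uncolored G c).ncard := by
    have hsub : uncolored G (recolor (gapCycle G c i j x y) c g) ⊆
        insert s(v, a) (uncolored G c \ {s(x, y)}) := by
      rintro e ⟨he, h1⟩
      unfold recolor at h1
      split_ifs at h1 with hmem
      · left
        refine hk.inj hmem ha ?_
        rw [hka]
        simp only [g] at h1
        by_contra h0
        rw [if_neg h0] at h1
        split_ifs at h1
      · right
        refine ⟨⟨he, h1⟩, ?_⟩
        rintro rfl
        exact hmem (h.adj_gapCycle hc)
    have h1 := Set.ncard_le_ncard hsub (Set.toFinite _)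
    have h2 := Set.ncard_insert_le s(v, a) (uncolored G c \ {s(x, y)})
    have h4 := Set.ncard_sdiff_singleton_add_one (s := uncolored G c) (a := s(x, y))
      ⟨h.adj, h.eq_none⟩ (Set.toFinite _)
    omega
  refine ⟨_, ⟨hnew, fun c' hc' => hle.trans (hc.2 c' hc')⟩, fun e he => if_neg he, ?_, a, ha, ?_⟩
  · intro w hw
    by_cases hl : (gapCycle G c i j x y).Adj v w
    · rw [recolor_of_adj hl]
      obtain ⟨p, q, hpq, hiff⟩ := h.exists_neighbors hc hv
      have : w = a ∨ w = b := by
        have h1 := (hiff w).1 hl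
        have h2 := (hiff a).1 ha
        have h4 := (hiff b).1 hb
        grind
      rcases this with rfl | rfl
      · simp [hga]
      · rw [hgb]
        simpa using hts
    · rw [recolor_of_not_adj hl]
      intro hcol
      refine hl (gapCycle_adj_of_color hv hw ?_)
      rcases hs with rfl | rfl
      · exact Or.inl hcol
      · exact Or.inr hcol
  · rw [recolor_of_adj ha, hga]

end

/-! ### Triangle-free graphs -/

section

variable {V : Type u} {G : SimpleGraph V} {c : Sym2 V → Option (Fin 3)} {i j : Fin 3} {x y : V}

/-- A walk cut at its first vertex in `S` uses only steps that start outside `S`. -/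
theorem exists_reachable_first_hit {K K' : SimpleGraph V} {S : Set V}
    (h : ∀ u w, K.Adj u w → u ∉ S → K'.Adj u w) {a b : V} (p : K.Walk a b) (ha : a ∉ S)
    (hb : b ∈ S) : ∃ u ∈ S, K'.Reachable a u := by
  induction p with
  | nil => exact absurd hb ha
  | @cons a w b hadj p ih =>
    by_cases hw : w ∈ S
    · exact ⟨w, hw, (h _ _ hadj ha).reachable⟩
    · obtain ⟨u, hu, hr⟩ := ih hw hb
      exact ⟨u, hu, (h _ _ hadj ha).reachable.trans hr⟩

theorem exists_isGap [Finite V] (hG : Subcubic G) (hc : IsOptimal G c) (hxy : G.Adj x y)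
    (hn : c s(x, y) = none) : ∃ i j, IsGap G c i j x y := by
  obtain ⟨i, hi⟩ := exists_missing hG hxy hn
  obtain ⟨j, hj⟩ := exists_missing hG hxy.symm (by rwa [Sym2.eq_swap])
  exact ⟨i, j, hxy, hn, fun h => hc.not_missing_common hxy hn hi (h ▸ hj), hi, hj⟩

/-- The ends of any other uncolored edge are not on the cycle of a gap. -/
theorem IsGap.not_reachable_of_uncolored [Finite V] (hG : Subcubic G) (hc : IsOptimal G c)
    (h : IsGap G c i j x y) {a b : V} (hab : G.Adj a b) (hn : c s(a, b) = none)
    (hne : s(a, b) ≠ s(x, y)) : ¬ (kempe G c i j).Reachable x a := by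
  intro ha
  -- Moving the gap to `a` would create two uncolored edges at `a`.
  obtain ⟨c', hc', hold, -, w, hw, hcw⟩ := h.rotate hc ha (Or.inl rfl)
  have hnot : ¬ (gapCycle G c i j x y).Adj a b := by
    rintro ⟨-, -, -, h1 | h1 | h1⟩
    · exact hne h1
    · simp [hn] at h1
    · simp [hn] at h1
  have := hc'.uncolored_matching hG hw.2.2.1 hab hcw ((hold _ hnot).trans hn)
  exact hnot (this ▸ hw)

/-- The cycles of two different gaps are vertex-disjoint. -/
theorem IsGap.disjoint [Finite V] (hG : Subcubic G) (hc : IsOptimal G c)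
    (h : IsGap G c i j x y) {i' j' : Fin 3} {x' y' : V} (h' : IsGap G c i' j' x' y')
    (hne : s(x', y') ≠ s(x, y)) {v : V} (hv : (kempe G c i j).Reachable x v)
    (hv' : (kempe G c i' j').Reachable x' v) : False := by
  -- Two pairs out of three colors intersect. With the first gap moved to the first vertex `u` where
  -- the second chain meets its cycle, so that `s` is missing at `u`, the second chain acquires a
  -- third end.
  obtain ⟨s, hs, hs'⟩ : ∃ s, (s = i ∨ s = j) ∧ (s = i' ∨ s = j') := by
    have h1 := h.ne
    have h2 := h'.ne
    clear * - h1 h2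
    revert i j i' j'
    decide
  set L := gapCycle G c i j x y
  set S : Set V := {u | (kempe G c i j).Reachable x u} with hS
  have hx' : x' ∉ S := h.not_reachable_of_uncolored hG hc h'.adj h'.eq_none hne
  have hy' : y' ∉ S := h.not_reachable_of_uncolored hG hc h'.adj.symm
    (by rw [Sym2.eq_swap, h'.eq_none]) (by rwa [Sym2.eq_swap])
  obtain ⟨p⟩ := hv'
  obtain ⟨u, hu, hr⟩ := exists_reachable_first_hit (K' := kempe G c i' j' \ L) (S := S)
    (fun u w huw hnu => ⟨huw, fun hl => hnu hl.1⟩) p hx' hv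
  obtain ⟨c', hc', hold, hmiss, -⟩ := h.rotate hc hu hs
  have hcol : ∀ {a b}, a ∉ S → c' s(a, b) = c s(a, b) := fun ha => hold _ fun hl => ha hl.1
  have hgap : IsGap G c' i' j' x' y' :=
    ⟨h'.adj, (hcol hx').trans h'.eq_none, h'.ne, fun w hw => by rw [hcol hx']; exact h'.left w hw,
      fun w hw => by rw [hcol hy']; exact h'.right w hw⟩
  have hle : kempe G c i' j' \ L ≤ kempe G c' i' j' := by
    rintro a b ⟨⟨hab, h1⟩, h2⟩
    exact ⟨hab, by rwa [hold _ h2]⟩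
  refine hc'.1.not_three_ends hgap.adj.ne (z := u) ?_ ?_ (Or.inl hgap.left) (Or.inr hgap.right)
    ?_ (hc'.reachable hgap.adj hgap.eq_none hgap.left hgap.right) (hr.mono hle)
  · rintro rfl
    exact hx' hu
  · rintro rfl
    exact hy' hu
  · rcases hs' with rfl | rfl
    · exact Or.inl hmiss
    · exact Or.inr hmiss

/-- Every edge of `G` can be given a pair out of seven colors, so that the pairs of adjacent edges
are disjoint. -/
def HasPairColoring (G : SimpleGraph V) : Prop :=
  ∃ φ : Sym2 V → Finset (Fin 7), (∀ e ∈ G.edgeSet, (φ e).card = 2) ∧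
    ∀ v a b, G.Adj v a → G.Adj v b → a ≠ b → Disjoint (φ s(v, a)) (φ s(v, b))

/-- The first of the two colors that replace the color `i`. -/
def fstColor (i : Fin 3) : Fin 7 := ![0, 2, 4] i

/-- The second of the two colors that replace the color `i`. -/
def sndColor (i : Fin 3) : Fin 7 := ![1, 3, 5] i

/-- The two colors that replace the color `i`. -/
def colorPair (i : Fin 3) : Finset (Fin 7) := {fstColor i, sndColor i}

/-- The pairs of colors along an odd cycle of length at least five. -/
def cyclePairs (i j : Fin 3) (m : ℕ) : Finset (Fin 7) :=
  if m = 1 then {fstColor j, sndColor j}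
  else if m = 2 then {6, fstColor i}
  else if m = 3 then {sndColor i, fstColor j}
  else if Even m ∧ m ≠ 0 then {sndColor j, 6}
  else {fstColor i, sndColor i}

/-! ### Finite checks on the pairs of colors -/

theorem card_colorPair (i : Fin 3) : (colorPair i).card = 2 := by
  revert i
  decide

theorem disjoint_colorPair (h : i ≠ j) : Disjoint (colorPair i) (colorPair j) := by
  revert i j
  decide

theorem card_cyclePairs (h : i ≠ j) (m : ℕ) : (cyclePairs i j m).card = 2 := by
  unfold cyclePairs
  split_ifs <;> revert i j <;> decide

theorem disjoint_cyclePairs_colorPair {k : Fin 3} (h : i ≠ j) (hi : k ≠ i) (hj : k ≠ j) (m : ℕ) :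
    Disjoint (cyclePairs i j m) (colorPair k) := by
  unfold cyclePairs
  split_ifs <;> revert i j k <;> decide

/-- Writing i, i' and j, j' for the two replacement colors, the sequence is ii', jj', 6i, i'j, j'6,
then ii' and j'6 alternately. The first five pairs are the double coloring of a 5-cycle by five
colors. -/
theorem disjoint_cyclePairs_succ (h : i ≠ j) (m : ℕ) :
    Disjoint (cyclePairs i j m) (cyclePairs i j (m + 1)) := by
  have hpar := Nat.even_add_one (n := m)
  unfold cyclePairs
  split_ifs <;> first | (exfalso; grind) | (clear * - h; revert i j; decide)

/-- For odd length at least five the last pair is j'6; for length three it would be 6i, which meets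
the pair ii' of edge 0. -/
theorem disjoint_cyclePairs_last (h : i ≠ j) {n : ℕ} (hn : Odd n) (h5 : 5 ≤ n) :
    Disjoint (cyclePairs i j (n - 1)) (cyclePairs i j 0) := by
  have hev : Even (n - 1) := by grind
  unfold cyclePairs
  rw [if_neg (by omega), if_neg (by omega), if_neg (by omega), if_pos ⟨hev, by omega⟩,
    if_neg (by omega), if_neg (by omega), if_neg (by omega), if_neg (by simp)]
  clear * - h
  revert i j
  decide

/-- `G` has no triangle. -/
def TriangleFree (G : SimpleGraph V) : Prop :=
  ∀ a b d, G.Adj a b → G.Adj b d → ¬ G.Adj d a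

theorem IsGap.exists_pairs [Finite V] (ht : TriangleFree G) (hc : IsOptimal G c)
    (h : IsGap G c i j x y) :
    ∃ k : Sym2 V → ℕ, ∀ u a b, (gapCycle G c i j x y).Adj u a →
      (gapCycle G c i j x y).Adj u b → a ≠ b →
      Disjoint (cyclePairs i j (k s(u, a))) (cyclePairs i j (k s(u, b))) := by
  obtain ⟨n, k, hk⟩ := h.exists_indexing hc Reachable.rfl
  have hn := h.odd hc hk
  have h3 := hk.three_le
  have hne : n ≠ 3 := by
    intro h3
    obtain ⟨a, b, h1, h2, h4⟩ := hk.triangle h3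
    exact ht _ _ _ h1.2.2.1 h2.2.2.1 h4.2.2.1
  have h5 : 5 ≤ n := by grind
  refine ⟨k, fun u a b ha hb hab => ?_⟩
  rcases hk.step ha hb hab with (h1 | ⟨h1, h2⟩) | (h1 | ⟨h1, h2⟩)
  · rw [h1]
    exact disjoint_cyclePairs_succ h.ne _
  · rw [h1, h2]
    exact disjoint_cyclePairs_last h.ne hn h5
  · rw [h1]
    exact (disjoint_cyclePairs_succ h.ne _).symm
  · rw [h1, h2]
    exact (disjoint_cyclePairs_last h.ne hn h5).symm

theorem hasPairColoring_of_triangleFree [Finite V] (hG : Subcubic G) (ht : TriangleFree G) :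
    HasPairColoring G := by
  classical
  obtain ⟨c, hc⟩ := exists_isOptimal G
  have hgap : ∀ e : uncolored G c, ∃ x y i j, (e : Sym2 V) = s(x, y) ∧ IsGap G c i j x y := by
    rintro ⟨e, he, hn⟩
    induction e with | _ x y
    obtain ⟨i, j, h⟩ := exists_isGap hG hc he hn
    exact ⟨x, y, i, j, rfl, h⟩
  choose X Y I J hE hgap using hgap
  choose K hK using fun e => (hgap e).exists_pairs ht hc
  let L : uncolored G c → SimpleGraph V := fun e => gapCycle G c (I e) (J e) (X e) (Y e)
  have huniq : ∀ {e f u a b}, (L e).Adj u a → (L f).Adj u b → e = f := by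
    intro e f u a b ha hb
    by_contra hef
    refine (hgap e).disjoint hG hc (hgap f) (fun h => hef ?_) ha.1 hb.1
    exact Subtype.ext ((hE e).trans (h.symm.trans (hE f).symm))
  let φ : Sym2 V → Finset (Fin 7) := fun g =>
    if h : ∃ e, g ∈ (L e).edgeSet then cyclePairs (I h.choose) (J h.choose) (K h.choose g)
    else (c g).elim ∅ colorPair
  have hφ : ∀ {e u a}, (L e).Adj u a → φ s(u, a) = cyclePairs (I e) (J e) (K e s(u, a)) := by
    intro e u a h
    have hex : ∃ e, s(u, a) ∈ (L e).edgeSet := ⟨e, h⟩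
    have heq : hex.choose = e := huniq hex.choose_spec h
    simp only [φ]
    rw [dif_pos hex, heq]
  have hφ' : ∀ {u a}, G.Adj u a → (∀ e, ¬ (L e).Adj u a) →
      ∃ k, c s(u, a) = some k ∧ φ s(u, a) = colorPair k := by
    intro u a hadj h
    have hex : ¬ ∃ e, s(u, a) ∈ (L e).edgeSet := fun ⟨e, he⟩ => h e he
    cases hca : c s(u, a) with
    | none =>
      exfalso
      let e : uncolored G c := ⟨s(u, a), hadj, hca⟩
      apply h e
      have := (hgap e).adj_gapCycle hc
      rwa [← mem_edgeSet, ← hE e] at this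
    | some k =>
      refine ⟨k, rfl, ?_⟩
      simp only [φ]
      rw [dif_neg hex, hca]
      rfl
  -- An edge leaving a cycle has the third color, whose pair is not used on that cycle.
  have hmix : ∀ {e u a b}, (L e).Adj u a → G.Adj u b → (∀ e, ¬ (L e).Adj u b) →
      Disjoint (φ s(u, a)) (φ s(u, b)) := by
    intro e u a b ha hb h
    obtain ⟨k, hk, hk'⟩ := hφ' hb h
    rw [hφ ha, hk']
    apply disjoint_cyclePairs_colorPair (hgap e).ne
    · rintro rfl
      exact h e (gapCycle_adj_of_color ha.1 hb (Or.inl hk))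
    · rintro rfl
      exact h e (gapCycle_adj_of_color ha.1 hb (Or.inr hk))
  refine ⟨φ, fun g hg => ?_, fun v a b ha hb hab => ?_⟩
  · induction g with | _ u a
    by_cases h : ∃ e, (L e).Adj u a
    · obtain ⟨e, he⟩ := h
      rw [hφ he, card_cyclePairs (hgap e).ne]
    · obtain ⟨k, -, hk⟩ := hφ' hg (not_exists.1 h)
      rw [hk, card_colorPair]
  · by_cases hla : ∃ e, (L e).Adj v a <;> by_cases hlb : ∃ e, (L e).Adj v b
    · obtain ⟨e, he⟩ := hla
      obtain ⟨f, hf⟩ := hlb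
      obtain rfl := huniq he hf
      rw [hφ he, hφ hf]
      exact hK e v a b he hf hab
    · obtain ⟨e, he⟩ := hla
      exact hmix he hb (not_exists.1 hlb)
    · obtain ⟨f, hf⟩ := hlb
      exact (hmix hf ha (not_exists.1 hla)).symm
    · obtain ⟨k, hk, hk'⟩ := hφ' ha (not_exists.1 hla)
      obtain ⟨l, hl, hl'⟩ := hφ' hb (not_exists.1 hlb)
      rw [hk', hl']
      apply disjoint_colorPair
      rintro rfl
      exact hab (hc.1.eq_of_eq_some ha hb hk hl)

end

/-! ### Diamonds -/

section

variable {V : Type u} {G : SimpleGraph V}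

theorem Subcubic.mono [Finite V] {G' : SimpleGraph V} (hG : Subcubic G) (h : G' ≤ G) :
    Subcubic G' := fun v =>
  (Set.ncard_le_ncard (fun _ hw => h hw) (Set.toFinite _)).trans (hG v)

/-- The edges of a diamond can be colored, whatever the colors at its two vertices of
degree two are. -/
theorem exists_diamond_pairs {A B : Finset (Fin 7)} (hA : A.card = 2) (hB : B.card = 2) :
    ∃ P Q R S T : Finset (Fin 7), (P.card = 2 ∧ Q.card = 2 ∧ R.card = 2 ∧ S.card = 2 ∧
      T.card = 2) ∧ (Disjoint P Q ∧ Disjoint P R ∧ Disjoint P S ∧ Disjoint P T) ∧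
      (Disjoint Q R ∧ Disjoint Q S ∧ Disjoint R T ∧ Disjoint S T) ∧
      Disjoint Q A ∧ Disjoint R A ∧ Disjoint S B ∧ Disjoint T B := by
  have hcompl := Finset.card_compl (A ∪ B)
  rw [Fintype.card_fin] at hcompl
  have hAB := Finset.card_union_add_card_inter A B
  -- If `A` and `B` are disjoint, only three colors are free, so the central edge takes one color
  -- from each. Otherwise at least four are free: opposite outer edges share a pair of them, and the
  -- central edge takes `A`.
  by_cases h : Disjoint A B
  · rw [Finset.card_union_of_disjoint h] at hcompl
    obtain ⟨a, a', ha, rfl⟩ := Finset.card_eq_two.1 hA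
    obtain ⟨b, b', hb, rfl⟩ := Finset.card_eq_two.1 hB
    obtain ⟨r, s, t, hrs, hrt, hst, hR⟩ := Finset.card_eq_three.1 (hcompl.trans (by omega))
    have hmem : ∀ q ∈ ({r, s, t} : Finset (Fin 7)), q ≠ a ∧ q ≠ a' ∧ q ≠ b ∧ q ≠ b' := by
      intro q hq
      rw [← hR] at hq
      simp only [Finset.mem_compl, Finset.mem_union, Finset.mem_insert, Finset.mem_singleton] at hq
      tauto
    have h1 := hmem r (by simp)
    have h2 := hmem s (by simp)
    have h3 := hmem t (by simp)
    have h4 : a ≠ b ∧ a ≠ b' ∧ a' ≠ b ∧ a' ≠ b' := by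
      simp only [Finset.disjoint_left, Finset.mem_insert, Finset.mem_singleton] at h
      grind
    refine ⟨{a, b}, {b', r}, {s, t}, {s, t}, {a', r}, ?_, ?_, ?_, ?_⟩
    · refine ⟨Finset.card_pair ?_, Finset.card_pair ?_, Finset.card_pair ?_, Finset.card_pair ?_,
        Finset.card_pair ?_⟩ <;> grind
    all_goals
      simp only [Finset.disjoint_left, Finset.mem_insert, Finset.mem_singleton]
      grind
  · have hpos : 0 < (A ∩ B).card := by
      rw [Finset.card_pos, ← Finset.not_disjoint_iff_nonempty_inter]
      exact h
    obtain ⟨U, hU, hU4⟩ := Finset.exists_subset_card_eq (s := (A ∪ B)ᶜ) (n := 4) (by omega)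
    obtain ⟨Q, hQ, hQ2⟩ := Finset.exists_subset_card_eq (s := U) (n := 2) (by omega)
    have hR2 : (U \ Q).card = 2 := by
      rw [Finset.card_sdiff_of_subset hQ]
      omega
    have hUA : Disjoint U A := by
      rw [Finset.disjoint_left]
      intro q hq hqA
      simpa [hqA] using hU hq
    have hUB : Disjoint U B := by
      rw [Finset.disjoint_left]
      intro q hq hqB
      simpa [hqB] using hU hq
    have hR : U \ Q ⊆ U := Finset.sdiff_subset
    exact ⟨A, Q, U \ Q, U \ Q, Q, ⟨hA, hQ2, hR2, hR2, hQ2⟩,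
      ⟨(hUA.mono_left hQ).symm, (hUA.mono_left hR).symm, (hUA.mono_left hR).symm,
        (hUA.mono_left hQ).symm⟩,
      ⟨Finset.disjoint_sdiff, Finset.disjoint_sdiff, Finset.sdiff_disjoint,
        Finset.sdiff_disjoint⟩, hUA.mono_left hQ, hUA.mono_left hR, hUB.mono_left hR,
        hUB.mono_left hQ⟩

theorem exists_pair_of_unique_neighbor {H : SimpleGraph V} {φ : Sym2 V → Finset (Fin 7)}
    (hφ : ∀ e ∈ H.edgeSet, (φ e).card = 2) {v : V}
    (h : ∀ a b, H.Adj v a → H.Adj v b → a = b) :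
    ∃ A : Finset (Fin 7), A.card = 2 ∧ ∀ u, H.Adj v u → φ s(v, u) = A := by
  by_cases hex : ∃ u, H.Adj v u
  · obtain ⟨u, hu⟩ := hex
    exact ⟨φ s(v, u), hφ _ hu, fun w hw => by rw [h w u hw hu]⟩
  · exact ⟨{0, 1}, rfl, fun u hu => (hex ⟨u, hu⟩).elim⟩

/-- `G` without the edges at `x` and `y`. -/
def isolate (G : SimpleGraph V) (x y : V) : SimpleGraph V where
  Adj a b := G.Adj a b ∧ a ≠ x ∧ a ≠ y ∧ b ≠ x ∧ b ≠ y
  symm := ⟨fun _ _ h => ⟨h.1.symm, h.2.2.2.1, h.2.2.2.2, h.2.1, h.2.2.1⟩⟩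
  loopless := ⟨fun a h => G.loopless.irrefl a h.1⟩

/-- `x` and `y` have no neighbors outside the diamond, and `z`, `w` have at most one further edge
each, so only two pairs constrain the five edges. If `z` and `w` are adjacent, these two pairs
coincide. -/
theorem hasPairColoring_of_diamond [Finite V] (hG : Subcubic G) {x y z w : V} (hxy : G.Adj x y)
    (hxz : G.Adj x z) (hyz : G.Adj y z) (hxw : G.Adj x w) (hyw : G.Adj y w) (hzw : z ≠ w)
    (h : HasPairColoring (isolate G x y)) : HasPairColoring G := by
  classical
  obtain ⟨φ', hcard, hdisj⟩ := h
  have hx : ∀ a, G.Adj x a → a = y ∨ a = z ∨ a = w := by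
    intro a ha
    by_contra! hne
    exact hG.not_four hxy hxz hxw ha hyz.ne hyw.ne hne.1.symm hzw hne.2.1.symm hne.2.2.symm
  have hy : ∀ a, G.Adj y a → a = x ∨ a = z ∨ a = w := by
    intro a ha
    by_contra! hne
    exact hG.not_four hxy.symm hyz hyw ha hxz.ne hxw.ne hne.1.symm hzw hne.2.1.symm hne.2.2.symm
  have hend : ∀ v, G.Adj x v → G.Adj y v → ∀ a b, (isolate G x y).Adj v a →
      (isolate G x y).Adj v b → a = b := by
    intro v hxv hyv a b ha hb
    by_contra hab
    exact hG.not_four hxv.symm hyv.symm ha.1 hb.1 hxy.ne ha.2.2.2.1.symm hb.2.2.2.1.symm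
      ha.2.2.2.2.symm hb.2.2.2.2.symm hab
  obtain ⟨A, hA, hzA⟩ := exists_pair_of_unique_neighbor hcard (hend z hxz hyz)
  obtain ⟨B, hB, hwB⟩ := exists_pair_of_unique_neighbor hcard (hend w hxw hyw)
  obtain ⟨P, Q, R, S, T, ⟨hP2, hQ2, hR2, hS2, hT2⟩, ⟨hPQ, hPR, hPS, hPT⟩, ⟨hQR, hQS, hRT, hST⟩,
    hQA, hRA, hSB, hTB⟩ := exists_diamond_pairs hA hB
  let φ : Sym2 V → Finset (Fin 7) := fun e =>
    if e = s(x, y) then P else if e = s(x, z) then Q else if e = s(y, z) then R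
    else if e = s(x, w) then S else if e = s(y, w) then T else φ' e
  have nxy := hxy.ne
  have nxz := hxz.ne
  have nyz := hyz.ne
  have nxw := hxw.ne
  have nyw := hyw.ne
  have eP : φ s(x, y) = P := by simp [φ]
  have eQ : φ s(x, z) = Q := by simp [φ]; grind
  have eR : φ s(y, z) = R := by simp [φ]; grind
  have eS : φ s(x, w) = S := by simp [φ]; grind
  have eT : φ s(y, w) = T := by simp [φ]; grind
  have eP' : φ s(y, x) = P := by rw [Sym2.eq_swap, eP]
  have eQ' : φ s(z, x) = Q := by rw [Sym2.eq_swap, eQ]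
  have eR' : φ s(z, y) = R := by rw [Sym2.eq_swap, eR]
  have eS' : φ s(w, x) = S := by rw [Sym2.eq_swap, eS]
  have eT' : φ s(w, y) = T := by rw [Sym2.eq_swap, eT]
  have hold : ∀ {a b}, (isolate G x y).Adj a b → φ s(a, b) = φ' s(a, b) := by
    rintro a b ⟨-, h1, h2, h3, h4⟩
    simp [φ, h1, h2, h3, h4]
  have hcases : ∀ {v a}, G.Adj v a → v ≠ x → v ≠ y →
      ((v = z ∨ v = w) ∧ (a = x ∨ a = y)) ∨ (isolate G x y).Adj v a := by
    intro v a ha hvx hvy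
    by_cases hax : a = x
    · subst hax
      have := hx v ha.symm
      exact Or.inl ⟨this.resolve_left hvy, Or.inl rfl⟩
    by_cases hay : a = y
    · subst hay
      have := hy v ha.symm
      exact Or.inl ⟨this.resolve_left hvx, Or.inr rfl⟩
    exact Or.inr ⟨ha, hvx, hvy, hax, hay⟩
  have hmix : ∀ {v a b}, ((v = z ∨ v = w) ∧ (a = x ∨ a = y)) → (isolate G x y).Adj v b →
      Disjoint (φ s(v, a)) (φ s(v, b)) := by
    rintro v a b ⟨rfl | rfl, rfl | rfl⟩ hb
    · rw [eQ', hold hb, hzA b hb]; exact hQA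
    · rw [eR', hold hb, hzA b hb]; exact hRA
    · rw [eS', hold hb, hwB b hb]; exact hSB
    · rw [eT', hold hb, hwB b hb]; exact hTB
  refine ⟨φ, fun e he => ?_, fun v a b ha hb hab => ?_⟩
  · simp only [φ]
    split_ifs with h1 h2 h3 h4 h5 <;> try assumption
    apply hcard
    induction e with | _ a b
    have ha : a ≠ x := by
      rintro rfl
      rcases hx b he with rfl | rfl | rfl <;> simp_all
    have ha' : a ≠ y := by
      rintro rfl
      rcases hy b he with rfl | rfl | rfl <;> simp_all [Sym2.eq_swap]
    rcases hcases he ha ha' with ⟨rfl | rfl, rfl | rfl⟩ | h6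
    · exact absurd Sym2.eq_swap h2
    · exact absurd Sym2.eq_swap h3
    · exact absurd Sym2.eq_swap h4
    · exact absurd Sym2.eq_swap h5
    · exact h6
  · by_cases hvx : v = x
    · subst hvx
      rcases hx a ha with rfl | rfl | rfl <;> rcases hx b hb with rfl | rfl | rfl <;>
        first | exact absurd rfl hab | skip
      all_goals simp only [eP, eQ, eS]
      all_goals first | assumption | (apply Disjoint.symm; assumption)
    by_cases hvy : v = y
    · subst hvy
      rcases hy a ha with rfl | rfl | rfl <;> rcases hy b hb with rfl | rfl | rfl <;>
        first | exact absurd rfl hab | skip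
      all_goals simp only [eP', eR, eT]
      all_goals first | assumption | (apply Disjoint.symm; assumption)
    rcases hcases ha hvx hvy with h1 | h1 <;> rcases hcases hb hvx hvy with h2 | h2
    · obtain ⟨rfl | rfl, rfl | rfl⟩ := h1 <;> obtain ⟨-, rfl | rfl⟩ := h2 <;>
        first | exact absurd rfl hab | skip
      all_goals simp only [eQ', eR', eS', eT']
      all_goals first | assumption | (apply Disjoint.symm; assumption)
    · exact hmix h1 h2
    · exact (hmix h2 h1).symm
    · rw [hold h1, hold h2]
      exact hdisj v a b h1 h2 hab

theorem ncard_edgeSet_isolate_lt [Finite V] {x y : V} (hxy : G.Adj x y) :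
    (isolate G x y).edgeSet.ncard < G.edgeSet.ncard := by
  apply Set.ncard_lt_ncard _ (Set.toFinite _)
  refine Set.ssubset_iff_exists.2 ⟨edgeSet_mono fun _ _ h => h.1, s(x, y), hxy, fun h => ?_⟩
  exact h.2.1 rfl

end

/-! ### Triangles -/

section

variable {V : Type u} {G : SimpleGraph V} {x y z : V}

/-- The sets are enlarged one at a time; the other two occupy at most four of the seven colors.
Smaller sets matter because a corner of a triangle may have no outer edge. -/
theorem exists_disjoint_pairs {A B C : Finset (Fin 7)} (hA : A.card ≤ 2) (hB : B.card ≤ 2)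
    (hC : C.card ≤ 2) (hAB : Disjoint A B) (hAC : Disjoint A C) (hBC : Disjoint B C) :
    ∃ A' B' C' : Finset (Fin 7), (A ⊆ A' ∧ A'.card = 2) ∧ (B ⊆ B' ∧ B'.card = 2) ∧
      (C ⊆ C' ∧ C'.card = 2) ∧ Disjoint A' B' ∧ Disjoint A' C' ∧ Disjoint B' C' := by
  have key : ∀ A B C : Finset (Fin 7), A.card ≤ 2 → B.card ≤ 2 → C.card ≤ 2 → Disjoint A B →
      Disjoint A C → ∃ A', A ⊆ A' ∧ A'.card = 2 ∧ Disjoint A' B ∧ Disjoint A' C := by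
    intro A B C hA hB hC hAB hAC
    have h1 := Finset.card_compl (B ∪ C)
    rw [Fintype.card_fin] at h1
    have h2 := Finset.card_union_le B C
    obtain ⟨A', h3, h4, h5⟩ := Finset.exists_subsuperset_card_eq (s := A) (t := (B ∪ C)ᶜ) (n := 2)
      (by
        intro q hq
        simp [Finset.disjoint_left.1 hAB hq, Finset.disjoint_left.1 hAC hq]) hA (by omega)
    have h6 := Finset.disjoint_left.2 fun q hq => Finset.mem_compl.1 (h4 hq)
    rw [Finset.disjoint_union_right] at h6
    exact ⟨A', h3, h5, h6.1, h6.2⟩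
  obtain ⟨A', h1, h2, h3, h4⟩ := key A B C hA hB hC hAB hAC
  obtain ⟨B', h5, h6, h7, h8⟩ := key B A' C hB h2.le hC h3.symm hBC
  obtain ⟨C', h9, h10, h11, h12⟩ := key C A' B' hC h2.le h6.le h4.symm h8.symm
  exact ⟨A', B', C', ⟨h1, h2⟩, ⟨h5, h6⟩, ⟨h9, h10⟩, h7.symm, h11.symm, h12.symm⟩

open Classical in
/-- The map that contracts `x` and `y` into `z`. -/
noncomputable def contractMap (x y z v : V) : V := if v = x ∨ v = y then z else v

/-- The graph obtained from `G` by contracting `x` and `y` into `z`. -/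
def contract (G : SimpleGraph V) (x y z : V) : SimpleGraph V where
  Adj a b := a ≠ b ∧ ∃ a' b', G.Adj a' b' ∧ contractMap x y z a' = a ∧ contractMap x y z b' = b
  symm := ⟨fun _ _ ⟨h, a', b', h1, h2, h3⟩ => ⟨h.symm, b', a', h1.symm, h3, h2⟩⟩
  loopless := ⟨fun _ h => h.1 rfl⟩

theorem contractMap_of_not_mem {v : V} (h : ¬ (v = x ∨ v = y ∨ v = z)) :
    contractMap x y z v = v := by
  rw [contractMap, if_neg]
  tauto

theorem contractMap_of_mem {v : V} (h : v = x ∨ v = y ∨ v = z) : contractMap x y z v = z := by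
  rw [contractMap]
  split_ifs <;> tauto

theorem contractMap_eq {v w : V} (h : contractMap x y z v = w) (hw : w ≠ z) : v = w := by
  rw [contractMap] at h
  split_ifs at h
  · exact absurd h.symm hw
  · exact h

theorem ncard_edgeSet_contract_lt [Finite V] (hxy : G.Adj x y) :
    (contract G x y z).edgeSet.ncard < G.edgeSet.ncard := by
  have hsub : (contract G x y z).edgeSet ⊆
      Sym2.map (contractMap x y z) '' (G.edgeSet \ {s(x, y)}) := by
    intro e
    induction e with | _ a b
    rintro ⟨hab, a', b', hadj, rfl, rfl⟩
    refine ⟨s(a', b'), ⟨hadj, ?_⟩, rfl⟩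
    intro h
    apply hab
    rcases Sym2.eq_iff.1 h with ⟨rfl, rfl⟩ | ⟨rfl, rfl⟩ <;>
      rw [contractMap_of_mem (by simp), contractMap_of_mem (by simp)]
  have h1 := Set.ncard_le_ncard hsub (Set.toFinite _)
  have h2 := Set.ncard_image_le (f := Sym2.map (contractMap x y z))
    (Set.toFinite (G.edgeSet \ {s(x, y)}))
  have h3 := Set.ncard_sdiff_singleton_lt_of_mem (s := G.edgeSet) (a := s(x, y)) hxy
    (Set.toFinite _)
  omega

/-- No two triangles of `G` have a common edge. -/
def DiamondFree (G : SimpleGraph V) : Prop :=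
  ∀ x y z w, G.Adj x y → G.Adj x z → G.Adj y z → G.Adj x w → G.Adj y w → z = w

/-- Each vertex of a triangle has at most one neighbor outside the triangle. -/
theorem Subcubic.external_unique [Finite V] (hG : Subcubic G) (hxy : G.Adj x y) (hyz : G.Adj y z)
    (hzx : G.Adj z x) {t a b : V} (ht : t = x ∨ t = y ∨ t = z)
    (ha : ¬ (a = x ∨ a = y ∨ a = z)) (hb : ¬ (b = x ∨ b = y ∨ b = z)) (hta : G.Adj t a)
    (htb : G.Adj t b) : a = b := by
  simp only [not_or] at ha hb
  by_contra hab
  rcases ht with rfl | rfl | rfl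
  · exact hG.not_four hxy hzx.symm hta htb hyz.ne (Ne.symm ha.2.1) (Ne.symm hb.2.1)
      (Ne.symm ha.2.2) (Ne.symm hb.2.2) hab
  · exact hG.not_four hyz hxy.symm hta htb hzx.ne (Ne.symm ha.2.2) (Ne.symm hb.2.2)
      (Ne.symm ha.1) (Ne.symm hb.1) hab
  · exact hG.not_four hzx hyz.symm hta htb hxy.ne (Ne.symm ha.1) (Ne.symm hb.1)
      (Ne.symm ha.2.1) (Ne.symm hb.2.1) hab

/-- A vertex outside a triangle has at most one neighbor in the triangle. -/
theorem DiamondFree.internal_unique (hD : DiamondFree G) (hxy : G.Adj x y) (hyz : G.Adj y z)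
    (hzx : G.Adj z x) {t t' w : V} (ht : t = x ∨ t = y ∨ t = z) (ht' : t' = x ∨ t' = y ∨ t' = z)
    (hw : ¬ (w = x ∨ w = y ∨ w = z)) (h : G.Adj t w) (h' : G.Adj t' w) : t = t' := by
  have h1 : ¬ (G.Adj x w ∧ G.Adj y w) := fun h =>
    hw (Or.inr (Or.inr (hD x y z w hxy hzx.symm hyz h.1 h.2).symm))
  have h2 : ¬ (G.Adj y w ∧ G.Adj z w) := fun h =>
    hw (Or.inl (hD y z x w hyz hxy.symm hzx h.1 h.2).symm)
  have h3 : ¬ (G.Adj z w ∧ G.Adj x w) := fun h =>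
    hw (Or.inr (Or.inl (hD z x y w hzx hyz.symm hxy h.1 h.2).symm))
  grind

/-- Each corner contributes at most one outer neighbor to the merged vertex. -/
theorem Subcubic.contract [Finite V] (hG : Subcubic G) (hxy : G.Adj x y) (hyz : G.Adj y z)
    (hzx : G.Adj z x) : Subcubic (contract G x y z) := by
  intro v
  by_cases hv : v = z
  · subst hv
    let E : V → Set V := fun t => {w | G.Adj t w ∧ ¬ (w = x ∨ w = y ∨ w = v)}
    have hE : ∀ t, (t = x ∨ t = y ∨ t = v) → (E t).ncard ≤ 1 := by
      intro t ht
      rw [Set.ncard_le_one (Set.toFinite _)]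
      exact fun a ha b hb => hG.external_unique hxy hyz hzx ht ha.2 hb.2 ha.1 hb.1
    have hsub : (ConflictFree.contract G x y v).neighborSet v ⊆ (E x ∪ E y) ∪ E v := by
      rintro w ⟨hne, a, b, hab, ha, hb⟩
      have hbw := contractMap_eq hb hne.symm
      subst hbw
      have hb' : ¬ (b = x ∨ b = y ∨ b = v) := fun h => hne (by rw [← hb, contractMap_of_mem h])
      by_cases ha' : a = x ∨ a = y ∨ a = v
      · rcases ha' with rfl | rfl | rfl
        · exact Or.inl (Or.inl ⟨hab, hb'⟩)
        · exact Or.inl (Or.inr ⟨hab, hb'⟩)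
        · exact Or.inr ⟨hab, hb'⟩
      · rw [contractMap_of_not_mem ha'] at ha
        exact absurd (Or.inr (Or.inr ha)) ha'
    have h1 := Set.ncard_le_ncard hsub (Set.toFinite _)
    have h2 := Set.ncard_union_le (E x ∪ E y) (E v)
    have h3 := Set.ncard_union_le (E x) (E y)
    have h4 := hE x (by simp)
    have h5 := hE y (by simp)
    have h6 := hE v (by simp)
    omega
  · have hsub : (ConflictFree.contract G x y z).neighborSet v ⊆
        contractMap x y z '' G.neighborSet v := by
      rintro w ⟨-, a, b, hab, ha, hb⟩
      have hav := contractMap_eq ha hv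
      exact ⟨b, hav ▸ hab, hb⟩
    exact ((Set.ncard_le_ncard hsub (Set.toFinite _)).trans
      (Set.ncard_image_le (Set.toFinite _))).trans (hG v)

-- The outer edges at the corners meet at the contracted vertex, so their pairs are disjoint;
-- without diamonds they remain distinct edges. A triangle edge avoids the pairs at its own ends by
-- taking that of the opposite corner.
set_option maxHeartbeats 1000000 in
theorem hasPairColoring_of_triangle [Finite V] (hG : Subcubic G) (hD : DiamondFree G)
    (hxy : G.Adj x y) (hyz : G.Adj y z) (hzx : G.Adj z x)
    (h : HasPairColoring (contract G x y z)) : HasPairColoring G := by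
  classical
  obtain ⟨φ', hcard, hdisj⟩ := h
  let T : V → Prop := fun v => v = x ∨ v = y ∨ v = z
  let D : V → Finset (Fin 7) := fun t =>
    if h : ∃ w, G.Adj t w ∧ ¬ T w then φ' s(z, h.choose) else ∅
  have hadjz : ∀ {t w}, T t → ¬ T w → G.Adj t w → (contract G x y z).Adj z w :=
    fun ht hw h => ⟨fun hzw => hw (Or.inr (Or.inr hzw.symm)), _, _, h, contractMap_of_mem ht,
      contractMap_of_not_mem hw⟩
  have hDw : ∀ {t w}, T t → ¬ T w → G.Adj t w → D t = φ' s(z, w) := by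
    intro t w ht hw h
    have hex : ∃ w, G.Adj t w ∧ ¬ T w := ⟨w, h, hw⟩
    simp only [D]
    rw [dif_pos hex, hG.external_unique hxy hyz hzx ht hex.choose_spec.2 hw hex.choose_spec.1 h]
  have hD0 : ∀ {t}, (¬ ∃ w, G.Adj t w ∧ ¬ T w) → D t = ∅ := fun h => dif_neg h
  have hD2 : ∀ t, T t → (D t).card ≤ 2 := by
    intro t ht
    by_cases hex : ∃ w, G.Adj t w ∧ ¬ T w
    · obtain ⟨w, hw, hTw⟩ := hex
      rw [hDw ht hTw hw, hcard _ (hadjz ht hTw hw)]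
    · simp [hD0 hex]
  have hDD : ∀ t t', T t → T t' → t ≠ t' → Disjoint (D t) (D t') := by
    intro t t' ht ht' hne
    by_cases hex : ∃ w, G.Adj t w ∧ ¬ T w
    · by_cases hex' : ∃ w, G.Adj t' w ∧ ¬ T w
      · obtain ⟨w, hw, hTw⟩ := hex
        obtain ⟨w', hw', hTw'⟩ := hex'
        rw [hDw ht hTw hw, hDw ht' hTw' hw']
        apply hdisj _ _ _ (hadjz ht hTw hw) (hadjz ht' hTw' hw')
        rintro rfl
        exact hne (hD.internal_unique hxy hyz hzx ht ht' hTw hw hw')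
      · simp [hD0 hex']
    · simp [hD0 hex]
  have Tx : T x := Or.inl rfl
  have Ty : T y := Or.inr (Or.inl rfl)
  have Tz : T z := Or.inr (Or.inr rfl)
  obtain ⟨A, B, C, ⟨hA, hA2⟩, ⟨hB, hB2⟩, ⟨hC, hC2⟩, hAB, hAC, hBC⟩ :=
    exists_disjoint_pairs (hD2 x Tx) (hD2 y Ty) (hD2 z Tz) (hDD x y Tx Ty hxy.ne)
      (hDD x z Tx Tz hzx.ne.symm) (hDD y z Ty Tz hyz.ne)
  have hext : ∀ {t w E}, T t → D t ⊆ E → E.card = 2 → ¬ T w → G.Adj t w → φ' s(z, w) = E := by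
    intro t w E ht hE hE2 hw h
    rw [hDw ht hw h] at hE
    exact Finset.eq_of_subset_of_card_le hE (by rw [hE2, hcard _ (hadjz ht hw h)])
  let φ : Sym2 V → Finset (Fin 7) := fun e =>
    if e = s(x, y) then C else if e = s(y, z) then A else if e = s(z, x) then B
    else φ' (e.map (contractMap x y z))
  have nxy := hxy.ne
  have nyz := hyz.ne
  have nzx := hzx.ne
  have eC : φ s(x, y) = C := by simp [φ]
  have eA : φ s(y, z) = A := by simp [φ]; grind
  have eB : φ s(z, x) = B := by simp [φ]; grind
  have eC' : φ s(y, x) = C := by rw [Sym2.eq_swap, eC]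
  have eA' : φ s(z, y) = A := by rw [Sym2.eq_swap, eA]
  have eB' : φ s(x, z) = B := by rw [Sym2.eq_swap, eB]
  have hout : ∀ {v a}, ¬ T v → φ s(v, a) = φ' s(v, contractMap x y z a) := by
    intro v a hv
    have hv' := hv
    simp only [T, not_or] at hv'
    simp only [φ]
    rw [if_neg, if_neg, if_neg, Sym2.map_mk, contractMap_of_not_mem hv]
    all_goals
      intro h
      rcases Sym2.eq_iff.1 h with ⟨h, -⟩ | ⟨h, -⟩ <;> simp_all
  have hadj' : ∀ {v a}, ¬ T v → G.Adj v a → (contract G x y z).Adj v (contractMap x y z a) := by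
    intro v a hv h
    refine ⟨?_, v, a, h, contractMap_of_not_mem hv, rfl⟩
    intro heq
    by_cases ha : T a
    · rw [contractMap_of_mem ha] at heq
      exact hv (Or.inr (Or.inr heq))
    · rw [contractMap_of_not_mem ha] at heq
      exact h.ne heq
  have hin : ∀ {t w E}, T t → D t ⊆ E → E.card = 2 → ¬ T w → G.Adj t w → φ s(t, w) = E := by
    intro t w E ht hE hE2 hw h
    rw [Sym2.eq_swap, hout hw, contractMap_of_mem ht, Sym2.eq_swap, hext ht hE hE2 hw h]
  have corner : ∀ {t p q : V} {E P Q : Finset (Fin 7)}, T t → (∀ v, T v ↔ v = t ∨ v = p ∨ v = q) →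
      D t ⊆ E → E.card = 2 → φ s(t, p) = Q → φ s(t, q) = P → Disjoint E P → Disjoint E Q →
      Disjoint P Q → ∀ a b, G.Adj t a → G.Adj t b → a ≠ b → Disjoint (φ s(t, a)) (φ s(t, b)) := by
    intro t p q E P Q ht hT hE hE2 hp hq hEP hEQ hPQ a b ha hb hab
    have hc : ∀ a, G.Adj t a → (a = p ∧ φ s(t, a) = Q) ∨ (a = q ∧ φ s(t, a) = P) ∨
        (¬ T a ∧ φ s(t, a) = E) := by
      intro a ha
      by_cases hTa : T a
      · rcases (hT a).1 hTa with rfl | rfl | rfl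
        · exact (ha.ne rfl).elim
        · exact Or.inl ⟨rfl, hp⟩
        · exact Or.inr (Or.inl ⟨rfl, hq⟩)
      · exact Or.inr (Or.inr ⟨hTa, hin ht hE hE2 hTa ha⟩)
    rcases hc a ha with ⟨h1, h2⟩ | ⟨h1, h2⟩ | ⟨h1, h2⟩ <;>
      rcases hc b hb with ⟨h3, h4⟩ | ⟨h3, h4⟩ | ⟨h3, h4⟩ <;>
      first
        | exact absurd (h1.trans h3.symm) hab
        | exact absurd (hG.external_unique hxy hyz hzx ht h1 h3 ha hb) hab
        | rw [h2, h4]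
          first | assumption | (apply Disjoint.symm; assumption)
  have hall : ∀ v a b, G.Adj v a → G.Adj v b → a ≠ b → Disjoint (φ s(v, a)) (φ s(v, b)) := by
    intro v a b ha hb hab
    by_cases hv : T v
    · rcases hv with rfl | rfl | rfl
      · exact corner Tx (fun _ => Iff.rfl) hA hA2 eC eB' hAB hAC hBC a b ha hb hab
      · exact corner (p := z) (q := x) Ty (fun _ => by simp only [T]; tauto) hB hB2 eA eC' hBC
          hAB.symm hAC.symm a b ha hb hab
      · exact corner (p := x) (q := y) Tz (fun _ => by simp only [T]; tauto) hC hC2 eB eA'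
          hAC.symm hBC.symm hAB a b ha hb hab
    · rw [hout hv, hout hv]
      apply hdisj _ _ _ (hadj' hv ha) (hadj' hv hb)
      intro heq
      by_cases hTa : T a <;> by_cases hTb : T b
      · exact hab (hD.internal_unique hxy hyz hzx hTa hTb hv ha.symm hb.symm)
      · rw [contractMap_of_mem hTa, contractMap_of_not_mem hTb] at heq
        exact hTb (Or.inr (Or.inr heq.symm))
      · rw [contractMap_of_not_mem hTa, contractMap_of_mem hTb] at heq
        exact hTa (Or.inr (Or.inr heq))
      · rw [contractMap_of_not_mem hTa, contractMap_of_not_mem hTb] at heq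
        exact hab heq
  refine ⟨φ, fun e he => ?_, hall⟩
  induction e with | _ a b
  by_cases ha : T a
  · by_cases hb : T b
    · have := he.ne
      rcases ha with rfl | rfl | rfl <;> rcases hb with rfl | rfl | rfl <;>
        first | exact absurd rfl this | simp only [eA, eB, eC, eA', eB', eC', hA2, hB2, hC2]
    · rw [Sym2.eq_swap, hout hb]
      exact hcard _ (hadj' hb he.symm)
  · rw [hout ha]
    exact hcard _ (hadj' ha he)

/-- Every graph of maximum degree at most three has a coloring of its edges by pairs out of seven
colors. -/
theorem Subcubic.hasPairColoring [Finite V] {G : SimpleGraph V} (hG : Subcubic G) :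
    HasPairColoring G := by
  induction hn : G.edgeSet.ncard using Nat.strong_induction_on generalizing G with
  | _ n ih
  subst hn
  by_cases hD : DiamondFree G
  · by_cases ht : TriangleFree G
    · exact hasPairColoring_of_triangleFree hG ht
    · simp only [TriangleFree, not_forall, not_not] at ht
      obtain ⟨x, y, z, hxy, hyz, hzx⟩ := ht
      exact hasPairColoring_of_triangle hG hD hxy hyz hzx
        (ih _ (ncard_edgeSet_contract_lt hxy) (hG.contract hxy hyz hzx) rfl)
  · simp only [DiamondFree, not_forall] at hD
    obtain ⟨x, y, z, w, hxy, hxz, hyz, hxw, hyw, hzw⟩ := hD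
    exact hasPairColoring_of_diamond hG hxy hxz hyz hxw hyw hzw
      (ih _ (ncard_edgeSet_isolate_lt hxy) (hG.mono fun _ _ h => h.1) rfl)

end

/-! ### Pair colorings and conflict-free incidence colorings -/

section Incidences

variable {V : Type u} {G : SimpleGraph V}

/-- For a common vertex `t` of the edges, the three clauses of a conflict correspond to `t` being
the vertex of both incidences, of exactly one, or of neither. -/
theorem conflicting_iff_exists_mem {i j : Incidence G} :
    Conflicting i j ↔ ∃ t, t ∈ i.1.2 ∧ t ∈ j.1.2 := by
  obtain ⟨⟨u, e⟩, he, hu⟩ := i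
  obtain ⟨⟨v, f⟩, hf, hv⟩ := j
  constructor
  · rintro (h | (h | h) | ⟨w, h, h'⟩)
    · exact ⟨u, hu, by simpa [show u = v from h] using hv⟩
    · exact ⟨v, by simp [← show s(u, v) = e from h], hv⟩
    · exact ⟨u, hu, by simp [← show s(u, v) = f from h]⟩
    · exact ⟨w, by simp [← show s(u, w) = e from h], by simp [← show s(v, w) = f from h']⟩
  · rintro ⟨t, hte, htf⟩
    by_cases h1 : u = t <;> by_cases h2 : v = t
    · exact Or.inl (h1.trans h2.symm)
    · subst h1
      exact Or.inr (Or.inl (Or.inr (Sym2.eq_swap.trans ((Sym2.mem_and_mem_iff h2).1 ⟨hv, htf⟩).symm)))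
    · subst h2
      exact Or.inr (Or.inl (Or.inl ((Sym2.mem_and_mem_iff h1).1 ⟨hu, hte⟩).symm))
    · exact Or.inr (Or.inr ⟨t, ((Sym2.mem_and_mem_iff h1).1 ⟨hu, hte⟩).symm,
        ((Sym2.mem_and_mem_iff h2).1 ⟨hv, htf⟩).symm⟩)

theorem HasPairColoring.exists_isConflictFree (h : HasPairColoring G) :
    ∃ ψ : Incidence G → Fin 7, IsConflictFree ψ := by
  classical
  obtain ⟨φ, hcard, hdisj⟩ := h
  choose a b hab hφ using fun e : G.edgeSet => Finset.card_eq_two.1 (hcard e e.2)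
  -- `Quot.out` orders the ends of an edge, which decides which of its incidences gets which color.
  let ψ : Incidence G → Fin 7 := fun i =>
    if i.1.1 = (Quot.out i.1.2).1 then a ⟨i.1.2, i.2.1⟩ else b ⟨i.1.2, i.2.1⟩
  have hmem : ∀ i, ψ i ∈ φ i.1.2 := by
    intro i
    have := hφ ⟨i.1.2, i.2.1⟩
    simp only [ψ]
    split_ifs <;> simp [this]
  refine ⟨ψ, fun i j hij hc => ?_⟩
  obtain ⟨t, hti, htj⟩ := conflicting_iff_exists_mem.1 hc
  by_cases he : i.1.2 = j.1.2
  · obtain ⟨⟨u, e⟩, hi, hu⟩ := i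
    obtain ⟨⟨v, f⟩, hj, hv⟩ := j
    obtain rfl : e = f := he
    have huv : u ≠ v := by
      rintro rfl
      exact hij rfl
    have hout : ∀ w ∈ e, w = (Quot.out e).1 ∨ w = (Quot.out e).2 := by
      intro w hw
      rw [← Quot.out_eq e] at hw
      exact Sym2.mem_iff.1 hw
    have h1 := hout u hu
    have h2 := hout v hv
    have h3 := hab ⟨e, hi⟩
    simp only [ψ]
    split_ifs with h4 h5 h5
    · exact (huv (h4.trans h5.symm)).elim
    · exact h3
    · exact h3.symm
    · exact (huv ((h1.resolve_left h4).trans (h2.resolve_left h5).symm)).elim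
  · have hi := hmem i
    have hj := hmem j
    obtain ⟨p, hp⟩ := hti
    obtain ⟨q, hq⟩ := htj
    have hai : G.Adj t p := by
      have := i.2.1
      rwa [hp] at this
    have haj : G.Adj t q := by
      have := j.2.1
      rwa [hq] at this
    intro heq
    rw [hp] at hi
    rw [hq, ← heq] at hj
    refine Finset.disjoint_left.1 (hdisj t p q hai haj ?_) hi hj
    rintro rfl
    exact he (hp.trans hq.symm)

/-! ### Counting incidences -/

theorem card_incidence [Finite V] : Nat.card (Incidence G) = 2 * G.edgeSet.ncard := by
  classical
  have := Fintype.ofFinite V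
  let f : G.Dart → Incidence G := fun d =>
    ⟨(d.fst, d.edge), d.edge_mem, Sym2.mem_mk_left _ _⟩
  have hf : Function.Bijective f := by
    constructor
    · intro d d' h
      have h1 : (d.fst, d.edge) = (d'.fst, d'.edge) := congrArg Subtype.val h
      rw [Prod.mk.injEq] at h1
      obtain ⟨h1, h2⟩ := h1
      apply Dart.ext
      apply Prod.ext h1
      have h3 : s(d.fst, d.snd) = s(d'.fst, d'.snd) := h2
      rw [h1] at h3
      exact Sym2.congr_right.1 h3
    · rintro ⟨⟨v, e⟩, he, w, hw⟩
      obtain rfl : e = s(v, w) := hw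
      exact ⟨⟨(v, w), he⟩, rfl⟩
  rw [← Nat.card_congr (Equiv.ofBijective f hf), Nat.card_eq_fintype_card,
    dart_card_eq_twice_card_edges, ← Set.ncard_coe_finset, coe_edgeFinset]

instance [Finite V] : Finite (Incidence G) := Subtype.finite

/-- Every color of a conflict-free coloring appears on a matching. -/
theorem IsConflictFree.card_incidence_le [Finite V] {k : ℕ} {φ : Incidence G → Fin k}
    (hφ : IsConflictFree φ) : 2 * G.edgeSet.ncard ≤ k * (Nat.card V / 2) := by
  classical
  have := Fintype.ofFinite V
  have := Fintype.ofFinite (Incidence G)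
  have hclass : ∀ a : Fin k, (Finset.univ.filter fun i => φ i = a).card ≤ Nat.card V / 2 := by
    intro a
    rw [Nat.le_div_iff_mul_le (by norm_num), Nat.card_eq_fintype_card]
    have hdisj : ∀ i ∈ Finset.univ.filter (fun i => φ i = a),
        ∀ j ∈ Finset.univ.filter (fun i => φ i = a), i ≠ j →
        Disjoint i.1.2.toFinset j.1.2.toFinset := by
      intro i hi j hj hij
      rw [Finset.disjoint_left]
      intro t hti htj
      rw [Sym2.mem_toFinset] at hti htj
      rw [Finset.mem_filter_univ] at hi hj
      exact hφ i j hij (conflicting_iff_exists_mem.2 ⟨t, hti, htj⟩) (hi.trans hj.symm)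
    have h2 := Finset.card_biUnion hdisj
    rw [Finset.sum_congr rfl fun i _ => Sym2.card_toFinset_of_not_isDiag i.1.2
      (G.not_isDiag_of_mem_edgeSet i.2.1), Finset.sum_const, smul_eq_mul] at h2
    rw [← h2]
    exact Finset.card_le_univ _
  rw [← card_incidence, Nat.card_eq_fintype_card, ← Finset.card_univ,
    Finset.card_eq_sum_card_fiberwise (f := φ) (t := Finset.univ) (fun _ _ => Finset.mem_univ _)]
  calc _ ≤ ∑ _a : Fin k, Nat.card V / 2 := Finset.sum_le_sum fun a _ => hclass a
    _ = _ := by simp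

/-- A conflict-free coloring restricts to subgraphs. -/
theorem IsConflictFree.comp_subgraph {C : Type*} {φ : Incidence G → C} (hφ : IsConflictFree φ)
    (H : G.Subgraph) : ∃ ψ : Incidence H.coe → C, IsConflictFree ψ := by
  let f : Incidence H.coe → Incidence G := fun i =>
    ⟨(i.1.1, i.1.2.map Subtype.val), by
      obtain ⟨⟨v, e⟩, he, hv⟩ := i
      induction e with | _ a b
      exact ⟨H.adj_sub he, Sym2.mem_map.2 ⟨v, hv, rfl⟩⟩⟩
  have hf : Function.Injective f := by
    intro i j h
    have h1 := congrArg Subtype.val h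
    simp only [f, Prod.mk.injEq] at h1
    exact Subtype.ext (Prod.ext (Subtype.ext h1.1)
      (Sym2.map.injective Subtype.val_injective h1.2))
  refine ⟨φ ∘ f, fun i j hij hc => hφ _ _ (fun h => hij (hf h)) ?_⟩
  obtain ⟨t, hti, htj⟩ := conflicting_iff_exists_mem.1 hc
  exact conflicting_iff_exists_mem.2
    ⟨t, Sym2.mem_map.2 ⟨t, hti, rfl⟩, Sym2.mem_map.2 ⟨t, htj, rfl⟩⟩

end Incidences

/-! ### The members of the class `𝒫` have too many edges for six matchings -/

section Overfull

variable {V : Type u}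

/-- A graph of odd order `n` with at least `(3n - 1) / 2` edges. -/
structure IsOverfull (G : SimpleGraph V) : Prop where
  finite : Finite V
  odd : Odd (Nat.card V)
  le : 3 * Nat.card V ≤ 2 * G.edgeSet.ncard + 1

/-- A coloring would give 3n - 1 ≤ 2|E| ≤ 6(n - 1)/2 = 3n - 3. -/
theorem IsOverfull.not_isConflictFree {G : SimpleGraph V} (hG : IsOverfull G) {k : ℕ} (hk : k ≤ 6)
    {φ : Incidence G → Fin k} : ¬ IsConflictFree φ := by
  intro hφ
  have := hG.finite
  have h1 := hφ.card_incidence_le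
  have h2 := Nat.mul_le_mul_right (Nat.card V / 2) hk
  have h3 := hG.le
  have h4 := Nat.odd_iff.1 hG.odd
  omega

theorem IsOverfull.iso {V W : Type*} {G : SimpleGraph V} {G' : SimpleGraph W} (hG : IsOverfull G)
    (e : Nonempty (G' ≃g G)) : IsOverfull G' := by
  obtain ⟨e⟩ := e
  have := hG.finite
  have hV := Nat.card_congr e.toEquiv
  have hE : G'.edgeSet.ncard = G.edgeSet.ncard := Nat.card_congr e.mapEdgeSet
  exact ⟨Finite.of_equiv V e.toEquiv.symm, by rw [hV]; exact hG.odd,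
    by rw [hV, hE]; exact hG.le⟩

/-! ### Edge counts under pasting -/

theorem identify_injective {C : Type} {z₁ z₂ : V} (h : z₁ ≠ z₂) :
    Function.Injective (identify (C := C) z₁ z₂) := by
  rintro (a | _ | _) (b | _ | _) hab <;> simp_all [identify]

instance : Finite Terminal :=
  Finite.of_injective (fun t : Terminal => (match t with | .x => 0 | .y => 1 : Fin 2)) (by
    rintro (_ | _) (_ | _) h <;> simp_all)

/-- The two images could share only the edge `z₁z₂`, which `B` supplies only if its terminals are
adjacent. -/
theorem ncard_edgeSet_paste [Finite V] {C : Type} [Finite C] (A : SimpleGraph V)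
    (B : SimpleGraph (C ⊕ Terminal)) {z₁ z₂ : V} (h : z₁ ≠ z₂)
    (hB : ¬ B.Adj (Sum.inr .x) (Sum.inr .y)) :
    (paste A B z₁ z₂).edgeSet.ncard = A.edgeSet.ncard + B.edgeSet.ncard := by
  have hinl : Function.Injective (Sym2.map (Sum.inl : V → V ⊕ C)) :=
    Sym2.map.injective Sum.inl_injective
  have hid : Function.Injective (Sym2.map (identify (C := C) z₁ z₂)) :=
    Sym2.map.injective (identify_injective h)
  have hdisj : Disjoint (Sym2.map (Sum.inl : V → V ⊕ C) '' A.edgeSet)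
      (Sym2.map (identify z₁ z₂) '' B.edgeSet) := by
    rw [Set.disjoint_left]
    rintro _ ⟨e, -, rfl⟩ ⟨f, hf, hef⟩
    induction e with | _ a b
    induction f with | _ p q
    rw [Sym2.map_mk, Sym2.map_mk] at hef
    rcases p with p | _ | _ <;> rcases q with q | _ | _ <;>
      first
        | (rcases Sym2.eq_iff.1 hef with ⟨h1, h2⟩ | ⟨h1, h2⟩ <;> simp_all [identify]; done)
        | exact hB hf
        | exact hB hf.symm
  rw [paste, edgeSet_fromEdgeSet, sdiff_eq_left.2, Set.ncard_union_eq hdisj (Set.toFinite _)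
    (Set.toFinite _), Set.ncard_image_of_injective _ hinl, Set.ncard_image_of_injective _ hid]
  rw [Set.disjoint_left]
  rintro _ (⟨e, he, rfl⟩ | ⟨e, he, rfl⟩) hd
  · induction e with | _ a b
    exact he.ne (Sum.inl_injective hd)
  · induction e with | _ a b
    exact he.ne (identify_injective h hd)

theorem ncard_edgeSet_le_induce [Finite V] (G : SimpleGraph V) {z a b : V}
    (hz : G.neighborSet z = {a, b}) :
    G.edgeSet.ncard ≤ (G.induce {z}ᶜ).edgeSet.ncard + 2 := by
  have hsub : G.edgeSet ⊆
      Sym2.map Subtype.val '' (G.induce {z}ᶜ).edgeSet ∪ {s(z, a), s(z, b)} := by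
    intro e
    induction e with | _ p q
    intro he
    have hz' : ∀ q, G.Adj z q → s(z, q) ∈ ({s(z, a), s(z, b)} : Set (Sym2 V)) := by
      intro q hq
      have : q ∈ ({a, b} : Set V) := hz ▸ hq
      rcases this with rfl | rfl <;> simp
    by_cases hp : p = z
    · subst hp
      exact Or.inr (hz' q he)
    · by_cases hq : q = z
      · subst hq
        exact Or.inr ((Sym2.eq_swap (a := p) (b := q)).symm ▸ hz' p he.symm)
      · exact Or.inl ⟨s(⟨p, hp⟩, ⟨q, hq⟩), he, rfl⟩
  have h1 := Set.ncard_le_ncard hsub (Set.toFinite _)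
  have h2 := Set.ncard_union_le (Sym2.map Subtype.val '' (G.induce {z}ᶜ).edgeSet)
    {s(z, a), s(z, b)}
  have h3 := Set.ncard_image_le (f := Sym2.map Subtype.val)
    (Set.toFinite (G.induce ({z}ᶜ : Set V)).edgeSet)
  have h4 := Set.ncard_insert_le s(z, a) {s(z, b)}
  rw [Set.ncard_singleton] at h4
  omega

/-- Replacing a vertex of degree two by a configuration with `2m + 1` vertices and `3m + 2` edges
keeps a graph overfull. -/
theorem IsOverfull.paste_induce {G : SimpleGraph V} (hG : IsOverfull G) {C : Type} [Finite C]
    {B : SimpleGraph (C ⊕ Terminal)} {m : ℕ} (hC : Nat.card C = 2 * m + 1)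
    (hBe : 3 * m + 2 ≤ B.edgeSet.ncard) (hB : ¬ B.Adj (Sum.inr .x) (Sum.inr .y))
    {z : V} {z₁ z₂ : ({z}ᶜ : Set V)} (hne : z₁ ≠ z₂)
    (hz : G.neighborSet z = {(z₁ : V), (z₂ : V)}) :
    IsOverfull (paste (G.induce {z}ᶜ) B z₁ z₂) := by
  have := hG.finite
  have h1 := ncard_edgeSet_paste (G.induce {z}ᶜ) B hne hB
  have h2 := ncard_edgeSet_le_induce G hz
  have h3 := Set.ncard_add_ncard_compl ({z} : Set V)
  rw [Set.ncard_singleton, ← Nat.card_coe_set_eq] at h3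
  have h4 : Nat.card (({z}ᶜ : Set V) ⊕ C) = Nat.card ({z}ᶜ : Set V) + Nat.card C := Nat.card_sum
  have h5 := hG.le
  have h6 := Nat.odd_iff.1 hG.odd
  -- With `z` and its two edges removed, the order grows by 2m and the size by at least 3m.
  exact ⟨inferInstance, by rw [Nat.odd_iff]; omega, by omega⟩

/-- Replacing an edge by a configuration with `2m` vertices and `3m + 1` edges keeps a graph
overfull. -/
theorem IsOverfull.paste_deleteEdges {G : SimpleGraph V} (hG : IsOverfull G) {C : Type} [Finite C]
    {B : SimpleGraph (C ⊕ Terminal)} {m : ℕ} (hC : Nat.card C = 2 * m)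
    (hBe : 3 * m + 1 ≤ B.edgeSet.ncard) (hB : ¬ B.Adj (Sum.inr .x) (Sum.inr .y))
    {z₁ z₂ : V} (hz : G.Adj z₁ z₂) :
    IsOverfull (paste (G.deleteEdges {s(z₁, z₂)}) B z₁ z₂) := by
  have := hG.finite
  have h1 := ncard_edgeSet_paste (G.deleteEdges {s(z₁, z₂)}) B hz.ne hB
  have h2 := Set.ncard_sdiff_singleton_add_one (s := G.edgeSet) (a := s(z₁, z₂)) hz
    (Set.toFinite _)
  rw [← edgeSet_deleteEdges] at h2
  have h4 : Nat.card (V ⊕ C) = Nat.card V + Nat.card C := Nat.card_sum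
  have h5 := hG.le
  have h6 := Nat.odd_iff.1 hG.odd
  exact ⟨inferInstance, by rw [Nat.odd_iff]; omega, by omega⟩

theorem isOverfull_K4plus : IsOverfull K4plus := by
  refine ⟨inferInstance, by simp; decide, ?_⟩
  have : K4plus.edgeSet.ncard = 7 := by
    have h : K4plus.edgeSet = (({s(0, 4), s(4, 1), s(0, 2), s(0, 3), s(1, 2), s(1, 3), s(2, 3)} :
        Finset (Sym2 (Fin 5))) : Set (Sym2 (Fin 5))) := by
      rw [K4plus, edgeSet_fromEdgeSet, sdiff_eq_left.2]
      · simp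
      · rw [Set.disjoint_left]
        rintro e he hd
        simp only [Set.mem_insert_iff, Set.mem_singleton_iff] at he
        rcases he with rfl | rfl | rfl | rfl | rfl | rfl | rfl <;> simp at hd
    rw [h, Set.ncard_coe_finset]
    decide
  simp [this]

/-- The vertices of `G₂` in a row. -/
def equivG2Core : G2Core ≃ Fin 3 where
  toFun | .u => 0 | .v => 1 | .w => 2
  invFun := ![.u, .v, .w]
  left_inv a := by cases a <;> rfl
  right_inv a := by fin_cases a <;> rfl

/-- The vertices of `G₄` in a row. -/
def equivG4Core : G4Core ≃ Fin 5 where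
  toFun | .u0 => 0 | .u1 => 1 | .v0 => 2 | .v1 => 3 | .w => 4
  invFun := ![.u0, .u1, .v0, .v1, .w]
  left_inv a := by cases a <;> rfl
  right_inv a := by fin_cases a <;> rfl

/-- The vertices of `G₈` in a row. -/
def equivG8Core : G8Core ≃ Fin 5 where
  toFun | .u0 => 0 | .u1 => 1 | .u2 => 2 | .v0 => 3 | .v1 => 4
  invFun := ![.u0, .u1, .u2, .v0, .v1]
  left_inv a := by cases a <;> rfl
  right_inv a := by fin_cases a <;> rfl

/-- The vertices of `H_t` by kind. -/
def equivHCore (t : ℕ) : HCore t ≃ Fin 2 ⊕ (Fin t ⊕ Fin t) where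
  toFun
    | .xp => .inl 0
    | .yp => .inl 1
    | .x i => .inr (.inl i)
    | .y i => .inr (.inr i)
  invFun
    | .inl k => ![.xp, .yp] k
    | .inr (.inl i) => .x i
    | .inr (.inr i) => .y i
  left_inv a := by cases a <;> rfl
  right_inv := by
    rintro (k | k | k)
    · fin_cases k <;> rfl
    · rfl
    · rfl

instance : Finite G2Core := Finite.of_equiv _ equivG2Core.symm
instance : Finite G4Core := Finite.of_equiv _ equivG4Core.symm
instance : Finite G8Core := Finite.of_equiv _ equivG8Core.symm
instance (t : ℕ) : Finite (HCore t) := Finite.of_equiv _ (equivHCore t).symm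

theorem ncard_edgeSet_configG2 : 5 ≤ configG2.edgeSet.ncard := by
  rw [configG2, edgeSet_fromEdgeSet, sdiff_eq_left.2]
  · repeat rw [Set.ncard_insert_of_notMem (by simp)]
    simp
  · rw [Set.disjoint_left]
    rintro e he hd
    simp only [Set.mem_insert_iff, Set.mem_singleton_iff] at he
    rcases he with rfl | rfl | rfl | rfl | rfl <;> simp at hd

theorem ncard_edgeSet_configG4 : 8 ≤ configG4.edgeSet.ncard := by
  rw [configG4, edgeSet_fromEdgeSet, sdiff_eq_left.2]
  · repeat rw [Set.ncard_insert_of_notMem (by simp)]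
    simp
  · rw [Set.disjoint_left]
    rintro e he hd
    simp only [Set.mem_insert_iff, Set.mem_singleton_iff] at he
    rcases he with rfl | rfl | rfl | rfl | rfl | rfl | rfl | rfl <;> simp at hd

theorem ncard_edgeSet_configG8 : 8 ≤ configG8.edgeSet.ncard := by
  rw [configG8, edgeSet_fromEdgeSet, sdiff_eq_left.2]
  · repeat rw [Set.ncard_insert_of_notMem (by simp)]
    simp
  · rw [Set.disjoint_left]
    rintro e he hd
    simp only [Set.mem_insert_iff, Set.mem_singleton_iff] at he
    rcases he with rfl | rfl | rfl | rfl | rfl | rfl | rfl | rfl <;> simp at hd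

/-! ### The size of the ladder configuration -/

section ConfigH

variable {t i j : ℕ}

theorem hx_ne_xp : hx t i ≠ Sum.inl .xp := by unfold hx; split_ifs <;> simp
theorem hx_ne_yp : hx t i ≠ Sum.inl .yp := by unfold hx; split_ifs <;> simp
theorem hy_ne_xp : hy t i ≠ Sum.inl .xp := by unfold hy; split_ifs <;> simp
theorem hy_ne_yp : hy t i ≠ Sum.inl .yp := by unfold hy; split_ifs <;> simp
theorem hx_ne_hy : hx t i ≠ hy t j := by unfold hx hy; split_ifs <;> simp
theorem hx_ne_terminal_y : hx t i ≠ Sum.inr .y := by unfold hx; split_ifs <;> simp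
theorem hy_ne_terminal_x : hy t i ≠ Sum.inr .x := by unfold hy; split_ifs <;> simp

theorem hx_injective (hi : i ≤ t) (hj : j ≤ t) (h : hx t i = hx t j) : i = j := by
  unfold hx at h
  split_ifs at h
  · simpa using h
  · omega

theorem hy_injective (hi : i ≤ t) (hj : j ≤ t) (h : hy t i = hy t j) : i = j := by
  unfold hy at h
  split_ifs at h
  · simpa using h
  · omega

/-- The terminals have index `t`, whereas the rungs stop at index `t - 1`. -/
theorem configH_not_adj : ¬ (configH t).Adj (Sum.inr .x) (Sum.inr .y) := by
  rintro ⟨(h | ⟨i, -, h | h⟩) | ⟨i, -, hi, h⟩, -⟩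
  · simp at h
  · rcases Sym2.eq_iff.1 h with ⟨-, h⟩ | ⟨-, h⟩ <;> exact hx_ne_terminal_y h.symm
  · rcases Sym2.eq_iff.1 h with ⟨h, -⟩ | ⟨h, -⟩ <;> exact hy_ne_terminal_x h.symm
  · have : hx t i = Sum.inl (.x ⟨i, hi⟩) := dif_pos hi
    rcases Sym2.eq_iff.1 h with ⟨h, -⟩ | ⟨-, h⟩ <;> simp [this] at h

theorem ncard_edgeSet_configH (ht : 1 ≤ t) : 3 * t + 4 ≤ (configH t).edgeSet.ncard := by
  let S : Set (Sym2 (HCore t ⊕ Terminal)) :=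
    {s(.inl .xp, .inl .yp), s(.inl .xp, hx t 0), s(.inl .xp, hy t 0),
      s(.inl .yp, hx t 0), s(.inl .yp, hy t 0)}
  let fX : Fin t → Sym2 (HCore t ⊕ Terminal) := fun i => s(hx t i, hx t (i + 1))
  let fY : Fin t → Sym2 (HCore t ⊕ Terminal) := fun i => s(hy t i, hy t (i + 1))
  -- The shift reflects that there is no rung at index 0. In all there are 5 + t + t + (t - 1) = 3t
  -- + 4 edges.
  let fR : Fin (t - 1) → Sym2 (HCore t ⊕ Terminal) := fun i => s(hx t (i + 1), hy t (i + 1))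
  have hS : S.ncard = 5 := by
    have h1 := @hx_ne_xp t 0
    have h2 := @hx_ne_yp t 0
    have h3 := @hy_ne_xp t 0
    have h4 := @hy_ne_yp t 0
    have h5 := @hx_ne_hy t 0 0
    simp only [S]
    repeat rw [Set.ncard_insert_of_notMem (by
      simp [h1, h2, h4, h5, h1.symm, h2.symm, h3.symm, h4.symm, h5.symm])]
    simp
  have hSmem : ∀ e ∈ S, Sum.inl .xp ∈ e ∨ Sum.inl .yp ∈ e := by
    rintro e (rfl | rfl | rfl | rfl | rfl) <;> simp
  have hX : (Set.range fX).ncard = t := by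
    rw [Set.ncard_range_of_injective, Nat.card_fin]
    intro i j h
    have hi := i.2
    have hj := j.2
    apply Fin.ext
    rcases Sym2.eq_iff.1 h with ⟨h, -⟩ | ⟨h, h'⟩
    · exact hx_injective (by omega) (by omega) h
    · have := hx_injective (by omega) (by omega) h
      have := hx_injective (by omega) (by omega) h'
      omega
  have hY : (Set.range fY).ncard = t := by
    rw [Set.ncard_range_of_injective, Nat.card_fin]
    intro i j h
    have hi := i.2
    have hj := j.2
    apply Fin.ext
    rcases Sym2.eq_iff.1 h with ⟨h, -⟩ | ⟨h, h'⟩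
    · exact hy_injective (by omega) (by omega) h
    · have := hy_injective (by omega) (by omega) h
      have := hy_injective (by omega) (by omega) h'
      omega
  have hR : (Set.range fR).ncard = t - 1 := by
    rw [Set.ncard_range_of_injective, Nat.card_fin]
    intro i j h
    have hi := i.2
    have hj := j.2
    apply Fin.ext
    rcases Sym2.eq_iff.1 h with ⟨h, -⟩ | ⟨h, -⟩
    · have := hx_injective (by omega) (by omega) h
      omega
    · exact absurd h hx_ne_hy
  have dRest : Disjoint S ((Set.range fX ∪ Set.range fY) ∪ Set.range fR) := by
    rw [Set.disjoint_left]
    rintro e he h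
    rcases h with (⟨i, rfl⟩ | ⟨i, rfl⟩) | ⟨i, rfl⟩ <;>
      rcases hSmem _ he with h | h <;>
      simp [fX, fY, fR, hx_ne_xp.symm, hx_ne_yp.symm, hy_ne_xp.symm, hy_ne_yp.symm] at h
  have dXY : Disjoint (Set.range fX) (Set.range fY) := by
    rw [Set.disjoint_left]
    rintro _ ⟨i, rfl⟩ ⟨j, h⟩
    rcases Sym2.eq_iff.1 h with ⟨h, -⟩ | ⟨h, -⟩ <;> exact hx_ne_hy h.symm
  have dR : Disjoint (Set.range fX ∪ Set.range fY) (Set.range fR) := by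
    rw [Set.disjoint_left]
    rintro _ (⟨i, rfl⟩ | ⟨i, rfl⟩) ⟨j, h⟩
    · rcases Sym2.eq_iff.1 h with ⟨-, h⟩ | ⟨-, h⟩ <;> exact hx_ne_hy h.symm
    · rcases Sym2.eq_iff.1 h with ⟨h, -⟩ | ⟨h, -⟩ <;> exact hx_ne_hy h
  have hsub : S ∪ ((Set.range fX ∪ Set.range fY) ∪ Set.range fR) ⊆ (configH t).edgeSet := by
    rw [configH, edgeSet_fromEdgeSet]
    rintro e he
    refine ⟨?_, ?_⟩
    · rcases he with he | (⟨i, rfl⟩ | ⟨i, rfl⟩) | ⟨i, rfl⟩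
      · exact Or.inl (Or.inl he)
      · exact Or.inl (Or.inr ⟨i, i.2, Or.inl rfl⟩)
      · exact Or.inl (Or.inr ⟨i, i.2, Or.inr rfl⟩)
      · have := i.2
        exact Or.inr ⟨i + 1, by omega, by omega, rfl⟩
    · rcases he with (rfl | rfl | rfl | rfl | rfl) | (⟨i, rfl⟩ | ⟨i, rfl⟩) | ⟨i, rfl⟩ <;> intro hd
      · simp at hd
      · exact hx_ne_xp hd.symm
      · exact hy_ne_xp hd.symm
      · exact hx_ne_yp hd.symm
      · exact hy_ne_yp hd.symm
      · have := hx_injective (by omega) (by omega) hd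
        omega
      · have := hy_injective (by omega) (by omega) hd
        omega
      · exact hx_ne_hy hd
  have hle := Set.ncard_le_ncard hsub (Set.toFinite _)
  rw [Set.ncard_union_eq dRest, Set.ncard_union_eq dR, Set.ncard_union_eq dXY, hS, hX, hY, hR]
    at hle
  omega

end ConfigH

theorem ClassP.isOverfull {G : SimpleGraph V} (hG : ClassP G) : IsOverfull G := by
  induction hG with
  | base h => exact isOverfull_K4plus.iso h
  | pasteG2 _ z z₁ z₂ hne hz h ih =>
    refine (ih.paste_induce (m := 1) ?_ ncard_edgeSet_configG2 ?_ hne hz).iso h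
    · rw [Nat.card_congr equivG2Core, Nat.card_fin]
    · simp [configG2]
  | pasteG4 _ z z₁ z₂ hne hz h ih =>
    refine (ih.paste_induce (m := 2) ?_ ncard_edgeSet_configG4 ?_ hne hz).iso h
    · rw [Nat.card_congr equivG4Core, Nat.card_fin]
    · simp [configG4]
  | pasteG8 _ z z₁ z₂ hne hz h ih =>
    refine (ih.paste_induce (m := 2) ?_ ncard_edgeSet_configG8 ?_ hne hz).iso h
    · rw [Nat.card_congr equivG8Core, Nat.card_fin]
    · simp [configG8]
  | pasteH _ z₁ z₂ hz t ht h ih =>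
    -- The 2t + 2 new vertices and 3t + 4 edges are 2m and 3m + 1 for m = t + 1.
    refine (ih.paste_deleteEdges (m := t + 1) ?_ ?_ configH_not_adj hz).iso h
    · rw [Nat.card_congr (equivHCore t), Nat.card_sum, Nat.card_sum, Nat.card_fin, Nat.card_fin]
      omega
    · exact (ncard_edgeSet_configH ht).trans' (by omega)

end Overfull

end ConflictFree

theorem mainTheorem2 {V : Type*} [Fintype V] (G : SimpleGraph V) [DecidableRel G.Adj]
    (hG : ConflictFree.ClassPPlus G) : ConflictFree.cfIncidenceChromaticNumber G = 7 := by
  obtain ⟨-, -, hdeg, H, hH⟩ := hG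
  have hsub : ConflictFree.Subcubic G := by
    intro v
    rw [← SimpleGraph.coe_neighborFinset, Set.ncard_coe_finset,
      SimpleGraph.card_neighborFinset_eq_degree, ← hdeg]
    exact G.degree_le_maxDegree v
  have hmem := hsub.hasPairColoring.exists_isConflictFree
  apply le_antisymm
  · exact Nat.sInf_le hmem
  -- The infimum is attained only because seven colors suffice; over an empty set it would be 0.
  · obtain ⟨φ, hφ⟩ := Nat.sInf_mem
      (s := {k : ℕ | ∃ φ : ConflictFree.Incidence G → Fin k, ConflictFree.IsConflictFree φ})
      ⟨7, hmem⟩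
    obtain ⟨ψ, hψ⟩ := hφ.comp_subgraph H
    by_contra hlt
    exact hH.isOverfull.not_isConflictFree (Nat.le_of_lt_succ (not_le.1 hlt)) hψ
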